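/- Let $d\ge 1$ be an integer. Fix a smooth radial function $\chi:\mathbb R^d\to\mathbb R$ supported in the ball $B(0,2)$, equal to $1$ in a neighborhood of $B(0,1)$, and such that $r\mapsto\chi(re)$ is nonincreasing on $[0,\infty)$ for every unit vector $e$. Put $\varphi(\xi)=\chi(\xi)-\chi(2\xi)$ and, for $m\in\mathbb Z$ and a tempered distribution $f\in\mathcal S'(\mathbb R^d)$ (complex-valued), $\dot\Delta_m f=\mathcal F^{-1}[\varphi(2^{-m}\xi)\widehat f(\xi)]$; the operators $\dot\Delta_m$ vanish on polynomials. For $p\in[1,\infty]$ and $s\in\mathbb R$, let $\dot B^s_{p,\infty}$ be the space of classes $f$ of tempered distributions modulo polynomials (with complex coefficients) such that $$\|f\|_{\dot B^s_{p,\infty}}=\sup_{m\in\mathbb Z}2^{ms}\|\dot\Delta_m f\|_{L^p}<\infty .$$ Let $\mathcal S'_h$ be the space of those $f\in\mathcal S'$ such that $\chi(\lambda\xi)\widehat f(\xi)\to 0$ in $\mathcal S'$ as $\lambda\to+\infty$, and let $\mathcal S'_h\cap\dot B^s_{p,\infty}$ be the subspace of those classes in $\dot B^s_{p,\infty}$ that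 have a representative in $\mathcal S'_h$. Finally, let $C^s_p$ be the closure of $\mathcal S'_h\cap\dot B^s_{p,\infty}$ in $\dot B^s_{p,\infty}$. Theorem. For every $p\in[1,\infty]$ and every real $s\ge d/p$ (with $d/\infty=0$), the space $C^s_p$ is not complemented in $\dot B^s_{p,\infty}$: there is no decomposition $\dot B^s_{p,\infty}=C^s_p\oplus G$ with continuous projections; equivalently, there is no bounded linear projection of $\dot B^s_{p,\infty}$ with range $C^s_p$. -/

import Mathlib

open scoped SchwartzMap FourierTransform ENNReal
open MeasureTheory Filter Topology

noncomputable section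

namespace HomBesov

/-- The Euclidean space `ℝ^d`. -/
abbrev Rn (d : ℕ) : Type := EuclideanSpace ℝ (Fin d)

/-! ### Polynomials as tempered distributions -/

section Polynomials

variable {d : ℕ}

/-- The polynomial function on `ℝ^d` given by a polynomial with complex coefficients. -/
def polyFun (P : MvPolynomial (Fin d) ℂ) (x : Rn d) : ℂ :=
  MvPolynomial.eval (fun i => ((x i : ℝ) : ℂ)) P

theorem coord_hasTemperateGrowth (i : Fin d) :
    (fun x : Rn d => ((x i : ℝ) : ℂ)).HasTemperateGrowth :=
  (Complex.ofRealCLM.comp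
    (EuclideanSpace.proj i : EuclideanSpace ℝ (Fin d) →L[ℝ] ℝ)).hasTemperateGrowth

theorem polyFun_hasTemperateGrowth (P : MvPolynomial (Fin d) ℂ) :
    (polyFun P).HasTemperateGrowth := by
  induction P using MvPolynomial.induction_on with
  | C a =>
    have h : polyFun (d := d) (MvPolynomial.C a) = fun _ => a := by
      funext x; simp [polyFun]
    rw [h]; exact Function.HasTemperateGrowth.const a
  | add p q hp hq =>
    have h : polyFun (p + q) = polyFun p + polyFun q := by
      funext x; simp [polyFun]
    rw [h]; exact hp.add hq
  | mul_X p i hp =>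
    have h : polyFun (p * MvPolynomial.X i) = fun x => polyFun p x * ((x i : ℝ) : ℂ) := by
      funext x; simp [polyFun]
    rw [h]; exact hp.mul (coord_hasTemperateGrowth i)

theorem integrable_smul_polyFun (u : 𝓢(Rn d, ℂ)) (P : MvPolynomial (Fin d) ℂ) :
    Integrable (fun x => u x • polyFun P x) := by
  have h := (SchwartzMap.smulLeftCLM ℂ (polyFun P) u).integrable (μ := volume)
  refine h.congr (Eventually.of_forall fun x => ?_)
  simp [SchwartzMap.smulLeftCLM_apply_apply (polyFun_hasTemperateGrowth P), mul_comm]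

/-- The tempered distribution `u ↦ ∫ u(x) P(x) dx` associated with a polynomial `P`. -/
def polyDistribution : MvPolynomial (Fin d) ℂ →ₗ[ℂ] 𝓢'(Rn d, ℂ) where
  toFun P := (polyFun_hasTemperateGrowth P).toTemperedDistribution volume
  map_add' P Q := by
    ext u
    have hP := integrable_smul_polyFun u P
    have hQ := integrable_smul_polyFun u Q
    simp only [Function.HasTemperateGrowth.toTemperedDistribution_apply, add_apply]
    rw [← integral_add hP hQ]
    congr 1; funext x; simp [polyFun, mul_add]
  map_smul' c P := by
    ext u
    simp only [Function.HasTemperateGrowth.toTemperedDistribution_apply, smul_apply,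
      RingHom.id_apply]
    rw [← integral_smul]
    congr 1; funext x; simp [polyFun]; ring

theorem polyDistribution_apply (P : MvPolynomial (Fin d) ℂ) (u : 𝓢(Rn d, ℂ)) :
    polyDistribution P u = ∫ x, u x • polyFun P x := rfl

variable (d) in
/-- The space of polynomials, as a subspace of `𝓢'(ℝ^d)`. -/
def polynomials : Submodule ℂ 𝓢'(Rn d, ℂ) :=
  LinearMap.range (polyDistribution (d := d))

variable (d) in
/-- Tempered distributions modulo polynomials. -/
abbrev DistModPoly : Type := 𝓢'(Rn d, ℂ) ⧸ polynomials d

/-- A polynomial is orthogonal to the Fourier transform of any Schwartz function that vanishes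
near the origin. -/
theorem polyDistribution_fourier_eq_zero (P : MvPolynomial (Fin d) ℂ) :
    ∀ h : 𝓢(Rn d, ℂ), (∀ᶠ ξ in 𝓝 (0 : Rn d), h ξ = 0) → polyDistribution P (𝓕 h) = 0 := by
  induction P using MvPolynomial.induction_on with
  | C a =>
    intro h hh
    have h0 : (𝓕⁻ (𝓕 h)) (0 : Rn d) = 0 := by
      rw [FourierTransform.fourierInv_fourier_eq]; exact hh.self_of_nhds
    rw [SchwartzMap.fourierInv_coe, Real.fourierInv_eq] at h0
    simp only [inner_zero_right, AddChar.map_zero_eq_one, one_smul] at h0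
    rw [polyDistribution_apply]
    simp only [polyFun, MvPolynomial.eval_C, smul_eq_mul]
    rw [integral_mul_const, h0, zero_mul]
  | add p q hp hq =>
    intro h hh
    rw [map_add, add_apply, hp h hh, hq h hh, add_zero]
  | mul_X p i hp =>
    intro h hh
    open LineDeriv in
    have hd : ∀ᶠ ξ in 𝓝 (0 : Rn d),
        (∂_{EuclideanSpace.single i (1 : ℝ)} h : 𝓢(Rn d, ℂ)) ξ = 0 := by
      filter_upwards [hh.eventually_nhds] with ξ hξ
      rw [SchwartzMap.lineDerivOp_apply_eq_fderiv]
      have : (h : Rn d → ℂ) =ᶠ[𝓝 ξ] fun _ => 0 := hξ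
      rw [this.fderiv_eq]; simp
    have key := hp _ hd
    rw [SchwartzMap.fourier_lineDerivOp_eq, map_smul] at key
    have hne : (2 * Real.pi * Complex.I : ℂ) ≠ 0 := by
      simp [Real.pi_ne_zero]
    have key' := (smul_eq_zero.mp key).resolve_left hne
    rw [polyDistribution_apply] at key' ⊢
    rw [← key']
    congr 1; funext x
    have hin : (fun y : Rn d => inner ℝ y (EuclideanSpace.single i (1 : ℝ))).HasTemperateGrowth := by
      fun_prop
    rw [SchwartzMap.smulLeftCLM_apply_apply hin]
    simp [polyFun, EuclideanSpace.inner_single_right]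
    ring

end Polynomials

/-! ### Littlewood-Paley theory -/

/-- A low frequency cut-off `χ`: a smooth radial function on `ℝ^d`, supported in the ball of
radius `2`, equal to `1` near the unit ball, and nonincreasing along rays from the origin. -/
structure Cutoff (d : ℕ) where
  /-- the function `χ` -/
  toFun : Rn d → ℝ
  smooth : ContDiff ℝ (⊤ : ℕ∞) toFun
  radial : ∀ ξ η : Rn d, ‖ξ‖ = ‖η‖ → toFun ξ = toFun η
  support_subset : tsupport toFun ⊆ Metric.closedBall 0 2
  eq_one : ∀ᶠ ξ in 𝓝ˢ (Metric.closedBall (0 : Rn d) 1), toFun ξ = 1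
  antitone : ∀ e : Rn d, ‖e‖ = 1 → AntitoneOn (fun r : ℝ => toFun (r • e)) (Set.Ici 0)

section LittlewoodPaley

variable {d : ℕ} (χ : Cutoff d)

/-- The symbol `ξ ↦ χ(l ξ)`. -/
def Cutoff.lowSymbol (l : ℝ) (ξ : Rn d) : ℂ := (χ.toFun (l • ξ) : ℂ)

/-- The function `φ(ξ) = χ(ξ) - χ(2ξ)`. -/
def Cutoff.phi (ξ : Rn d) : ℝ := χ.toFun ξ - χ.toFun ((2 : ℝ) • ξ)

/-- The symbol `φ_m(ξ) = φ(2^{-m} ξ)`. -/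
def Cutoff.blockSymbol (m : ℤ) (ξ : Rn d) : ℂ := (χ.phi ((2 : ℝ) ^ (-m) • ξ) : ℂ)

theorem Cutoff.lowSymbol_hasTemperateGrowth (l : ℝ) : (χ.lowSymbol l).HasTemperateGrowth := by
  have hc : HasCompactSupport χ.toFun :=
    (isCompact_closedBall (0 : Rn d) 2).of_isClosed_subset (isClosed_tsupport _) χ.support_subset
  have h1 : χ.toFun.HasTemperateGrowth := hc.hasTemperateGrowth χ.smooth
  have h2 : (fun ξ : Rn d => l • ξ).HasTemperateGrowth :=
    (l • ContinuousLinearMap.id ℝ (Rn d)).hasTemperateGrowth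
  exact Function.HasTemperateGrowth.comp (g := Complex.ofReal)
    Complex.ofRealCLM.hasTemperateGrowth (h1.comp h2)

theorem Cutoff.blockSymbol_eq (m : ℤ) :
    χ.blockSymbol m = χ.lowSymbol ((2 : ℝ) ^ (-m)) - χ.lowSymbol (2 * (2 : ℝ) ^ (-m)) := by
  funext ξ
  simp [Cutoff.blockSymbol, Cutoff.lowSymbol, Cutoff.phi, smul_smul]

theorem Cutoff.blockSymbol_hasTemperateGrowth (m : ℤ) :
    (χ.blockSymbol m).HasTemperateGrowth := by
  rw [χ.blockSymbol_eq]
  exact (χ.lowSymbol_hasTemperateGrowth _).sub (χ.lowSymbol_hasTemperateGrowth _)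

theorem Cutoff.lowSymbol_eventually_eq_one (l : ℝ) :
    ∀ᶠ ξ in 𝓝 (0 : Rn d), χ.lowSymbol l ξ = 1 := by
  have h1 : ∀ᶠ ξ in 𝓝 (0 : Rn d), χ.toFun ξ = 1 :=
    χ.eq_one.filter_mono (nhds_le_nhdsSet (Metric.mem_closedBall_self zero_le_one))
  have ht : Tendsto (fun ξ : Rn d => l • ξ) (𝓝 0) (𝓝 0) := by
    simpa using (continuous_const_smul l).tendsto (0 : Rn d)
  filter_upwards [ht.eventually h1] with ξ hξ
  simp [Cutoff.lowSymbol, hξ]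

/-- The homogeneous dyadic block `Δ_m f = φ(2^{-m} D) f` of a tempered distribution. -/
def dyadicBlock (m : ℤ) : 𝓢'(Rn d, ℂ) →L[ℂ] 𝓢'(Rn d, ℂ) :=
  TemperedDistribution.fourierMultiplierCLM ℂ (χ.blockSymbol m)

theorem dyadicBlock_polynomial (m : ℤ) :
    polynomials d ≤ LinearMap.ker (dyadicBlock χ m : 𝓢'(Rn d, ℂ) →ₗ[ℂ] 𝓢'(Rn d, ℂ)) := by
  rintro _ ⟨P, rfl⟩
  rw [LinearMap.mem_ker]
  ext u
  change polyDistribution P (𝓕 (SchwartzMap.smulLeftCLM ℂ (χ.blockSymbol m) (𝓕⁻ u))) = 0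
  apply polyDistribution_fourier_eq_zero
  filter_upwards [χ.lowSymbol_eventually_eq_one ((2 : ℝ) ^ (-m)),
    χ.lowSymbol_eventually_eq_one (2 * (2 : ℝ) ^ (-m))] with ξ h1 h2
  rw [SchwartzMap.smulLeftCLM_apply_apply (χ.blockSymbol_hasTemperateGrowth m),
    χ.blockSymbol_eq, Pi.sub_apply, h1, h2, sub_self, zero_smul]

/-- The homogeneous dyadic block of a class of distributions modulo polynomials. It does not
depend on the representative, since dyadic blocks of polynomials vanish. -/
def dyadicBlockMod (m : ℤ) : DistModPoly d →ₗ[ℂ] 𝓢'(Rn d, ℂ) :=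
  (polynomials d).liftQ (dyadicBlock χ m : 𝓢'(Rn d, ℂ) →ₗ[ℂ] 𝓢'(Rn d, ℂ))
    (dyadicBlock_polynomial χ m)

/-- Chemin's space `𝓢'_h` of homogeneous distributions: those `f ∈ 𝓢'` such that
`χ(l ξ) 𝓕f(ξ) → 0` in `𝓢'` as `l → +∞`. -/
def homogeneousDistributions : Submodule ℂ 𝓢'(Rn d, ℂ) where
  carrier := {f | Tendsto
    (fun l : ℝ => TemperedDistribution.smulLeftCLM ℂ (χ.lowSymbol l) (𝓕 f)) atTop (𝓝 0)}
  zero_mem' := by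
    have h : (𝓕 (0 : 𝓢'(Rn d, ℂ))) = 0 := FourierTransform.fourier_zero
    simp [h]
  add_mem' {f g} hf hg := by
    have h := Tendsto.add hf hg
    rw [add_zero] at h
    change Tendsto _ _ _
    simpa [FourierTransform.fourier_add] using h
  smul_mem' c f hf := by
    have h := Tendsto.const_smul hf c
    have e : c • (0 : 𝓢'(Rn d, ℂ)) = 0 := by ext u; simp
    rw [show 𝓝 (c • (0 : 𝓢'(Rn d, ℂ))) = 𝓝 0 from congrArg 𝓝 e] at h
    change Tendsto _ _ _
    simpa [FourierTransform.fourier_smul] using h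

end LittlewoodPaley

/-! ### The homogeneous Besov space with third index infinity -/

section Besov

variable {d : ℕ}

/-- The `L^p` norm of a tempered distribution; it is `∞` if the distribution is not given by an
`L^p` function. The `L^p` function that represents a distribution is unique, so that the infimum
is over at most one element. -/
def distLpNorm (p : ℝ≥0∞) [Fact (1 ≤ p)] (T : 𝓢'(Rn d, ℂ)) : ℝ≥0∞ :=
  ⨅ (g : Lp ℂ p (volume : Measure (Rn d))) (_ : Lp.toTemperedDistribution g = T), ‖g‖ₑ

variable (p : ℝ≥0∞) [Fact (1 ≤ p)]

theorem distLpNorm_toTemperedDistribution (g : Lp ℂ p (volume : Measure (Rn d))) :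
    distLpNorm p (Lp.toTemperedDistribution g) = ‖g‖ₑ := by
  refine le_antisymm (iInf_le_of_le g (iInf_le_of_le rfl le_rfl)) (le_iInf₂ fun g' hg' => ?_)
  have hker := Lp.ker_toTemperedDistributionCLM_eq_bot (F := ℂ) (E := Rn d) (μ := volume) (p := p)
  have hinj := LinearMap.ker_eq_bot.mp hker
  have : g' = g := hinj hg'
  rw [this]

theorem exists_of_distLpNorm_lt_top {T : 𝓢'(Rn d, ℂ)} (h : distLpNorm p T < ∞) :
    ∃ g : Lp ℂ p (volume : Measure (Rn d)), Lp.toTemperedDistribution g = T := by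
  simp only [distLpNorm, iInf_lt_iff] at h
  obtain ⟨g, hg, _⟩ := h
  exact ⟨g, hg⟩

theorem distLpNorm_zero : distLpNorm p (0 : 𝓢'(Rn d, ℂ)) = 0 := by
  have h := distLpNorm_toTemperedDistribution p (0 : Lp ℂ p (volume : Measure (Rn d)))
  have h0 : Lp.toTemperedDistribution (0 : Lp ℂ p (volume : Measure (Rn d))) = 0 :=
    map_zero (Lp.toTemperedDistributionCLM ℂ (volume : Measure (Rn d)) p)
  rw [h0] at h
  simpa using h

theorem distLpNorm_add_le (S T : 𝓢'(Rn d, ℂ)) :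
    distLpNorm p (S + T) ≤ distLpNorm p S + distLpNorm p T := by
  by_cases hS : distLpNorm p S < ∞
  · by_cases hT : distLpNorm p T < ∞
    · obtain ⟨f, rfl⟩ := exists_of_distLpNorm_lt_top p hS
      obtain ⟨g, rfl⟩ := exists_of_distLpNorm_lt_top p hT
      have h : Lp.toTemperedDistribution f + Lp.toTemperedDistribution g =
          Lp.toTemperedDistribution (f + g) :=
        (map_add (Lp.toTemperedDistributionCLM ℂ (volume : Measure (Rn d)) p) f g).symm
      rw [h]
      simp only [distLpNorm_toTemperedDistribution]
      exact enorm_add_le f g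
    · simp [not_lt_top_iff.mp hT]
  · simp [not_lt_top_iff.mp hS]

theorem distLpNorm_smul_le (c : ℂ) (T : 𝓢'(Rn d, ℂ)) (hT : distLpNorm p T < ∞) :
    distLpNorm p (c • T) ≤ ‖c‖ₑ * distLpNorm p T := by
  obtain ⟨f, rfl⟩ := exists_of_distLpNorm_lt_top p hT
  have h : c • Lp.toTemperedDistribution f = Lp.toTemperedDistribution (c • f) :=
    (map_smul (Lp.toTemperedDistributionCLM ℂ (volume : Measure (Rn d)) p) c f).symm
  rw [h]
  simp only [distLpNorm_toTemperedDistribution]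
  exact (enorm_smul c f).le

variable (χ : Cutoff d) (s : ℝ)

/-- The norm `sup_m 2^{ms} ‖Δ_m F‖_{L^p}` of a class of distributions modulo polynomials, with
value `∞` allowed. -/
def besovENorm (F : DistModPoly d) : ℝ≥0∞ :=
  ⨆ m : ℤ, ENNReal.ofReal ((2 : ℝ) ^ ((m : ℝ) * s)) * distLpNorm p (dyadicBlockMod χ m F)

theorem besovENorm_zero : besovENorm p χ s 0 = 0 := by
  simp [besovENorm, distLpNorm_zero]

theorem besovENorm_add_le (F G : DistModPoly d) :
    besovENorm p χ s (F + G) ≤ besovENorm p χ s F + besovENorm p χ s G := by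
  refine iSup_le fun m => ?_
  rw [map_add]
  calc _ ≤ ENNReal.ofReal ((2 : ℝ) ^ ((m : ℝ) * s)) *
        (distLpNorm p (dyadicBlockMod χ m F) + distLpNorm p (dyadicBlockMod χ m G)) := by
        gcongr; exact distLpNorm_add_le p _ _
    _ ≤ _ := by
        rw [mul_add]
        exact add_le_add
          (le_iSup (fun m : ℤ => ENNReal.ofReal ((2 : ℝ) ^ ((m : ℝ) * s)) *
            distLpNorm p (dyadicBlockMod χ m F)) m)
          (le_iSup (fun m : ℤ => ENNReal.ofReal ((2 : ℝ) ^ ((m : ℝ) * s)) *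
            distLpNorm p (dyadicBlockMod χ m G)) m)

theorem distLpNorm_lt_top_of_besovENorm {F : DistModPoly d} (hF : besovENorm p χ s F < ∞)
    (m : ℤ) : distLpNorm p (dyadicBlockMod χ m F) < ∞ := by
  have h := (le_iSup (fun m : ℤ => ENNReal.ofReal ((2 : ℝ) ^ ((m : ℝ) * s)) *
    distLpNorm p (dyadicBlockMod χ m F)) m).trans_lt hF
  by_contra hc
  rw [not_lt_top_iff.mp hc, ENNReal.mul_top (by simp; positivity)] at h
  exact lt_irrefl _ h

theorem besovENorm_smul_le (c : ℂ) {F : DistModPoly d} (hF : besovENorm p χ s F < ∞) :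
    besovENorm p χ s (c • F) ≤ ‖c‖ₑ * besovENorm p χ s F := by
  refine iSup_le fun m => ?_
  rw [map_smul]
  calc _ ≤ ENNReal.ofReal ((2 : ℝ) ^ ((m : ℝ) * s)) *
        (‖c‖ₑ * distLpNorm p (dyadicBlockMod χ m F)) := by
        gcongr
        exact distLpNorm_smul_le p c _ (distLpNorm_lt_top_of_besovENorm p χ s hF m)
    _ = ‖c‖ₑ * (ENNReal.ofReal ((2 : ℝ) ^ ((m : ℝ) * s)) *
        distLpNorm p (dyadicBlockMod χ m F)) := by ring
    _ ≤ _ := by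
        gcongr
        exact le_iSup (fun m : ℤ => ENNReal.ofReal ((2 : ℝ) ^ ((m : ℝ) * s)) *
            distLpNorm p (dyadicBlockMod χ m F)) m

/-- The classes of distributions modulo polynomials of finite Besov norm, as a subspace. -/
def besovSubmodule : Submodule ℂ (DistModPoly d) where
  carrier := {F | besovENorm p χ s F < ∞}
  zero_mem' := by simp [besovENorm_zero]
  add_mem' {F G} hF hG :=
    (besovENorm_add_le p χ s F G).trans_lt (ENNReal.add_lt_top.mpr ⟨hF, hG⟩)
  smul_mem' c _ hF :=
    (besovENorm_smul_le p χ s c hF).trans_lt (ENNReal.mul_lt_top enorm_lt_top hF)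

/-- The homogeneous Besov space with indices `s`, `p` and `∞`. This is a type of its own, so that
it carries the topology of the Besov norm and not the one induced by `𝓢'`. -/
def BesovSpace : Type := besovSubmodule p χ s

instance : AddCommGroup (BesovSpace p χ s) :=
  inferInstanceAs (AddCommGroup (besovSubmodule p χ s))

instance : Module ℂ (BesovSpace p χ s) :=
  inferInstanceAs (Module ℂ (besovSubmodule p χ s))

/-- The inclusion of the Besov space into the distributions modulo polynomials. -/
def BesovSpace.incl : BesovSpace p χ s →ₗ[ℂ] DistModPoly d :=
  (besovSubmodule p χ s).subtype

theorem BesovSpace.besovENorm_lt_top (F : BesovSpace p χ s) :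
    besovENorm p χ s (BesovSpace.incl p χ s F) < ∞ :=
  Subtype.property (p := fun F => F ∈ besovSubmodule p χ s) F

instance : Norm (BesovSpace p χ s) :=
  ⟨fun F => (besovENorm p χ s (BesovSpace.incl p χ s F)).toReal⟩

theorem BesovSpace.norm_def (F : BesovSpace p χ s) :
    ‖F‖ = (besovENorm p χ s (BesovSpace.incl p χ s F)).toReal := rfl

theorem BesovSpace.norm_smul_le' (c : ℂ) (F : BesovSpace p χ s) : ‖c • F‖ ≤ ‖c‖ * ‖F‖ := by
  have hF := BesovSpace.besovENorm_lt_top p χ s F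
  rw [BesovSpace.norm_def, BesovSpace.norm_def, map_smul, ← toReal_enorm c,
    ← ENNReal.toReal_mul]
  exact ENNReal.toReal_mono (ENNReal.mul_lt_top enorm_lt_top hF).ne
    (besovENorm_smul_le p χ s c hF)

theorem BesovSpace.core : SeminormedSpace.Core ℂ (BesovSpace p χ s) where
  norm_nonneg _ := ENNReal.toReal_nonneg
  norm_smul c F := by
    refine le_antisymm (BesovSpace.norm_smul_le' p χ s c F) ?_
    rcases eq_or_ne c 0 with rfl | hc
    · simp only [norm_zero, zero_mul]; exact ENNReal.toReal_nonneg
    · have h := BesovSpace.norm_smul_le' p χ s c⁻¹ (c • F)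
      rw [smul_smul, inv_mul_cancel₀ hc, one_smul, norm_inv] at h
      have hpos : 0 < ‖c‖ := norm_pos_iff.mpr hc
      rwa [← div_eq_inv_mul, le_div_iff₀' hpos] at h
  norm_triangle F G := by
    have hF := BesovSpace.besovENorm_lt_top p χ s F
    have hG := BesovSpace.besovENorm_lt_top p χ s G
    rw [BesovSpace.norm_def, BesovSpace.norm_def, BesovSpace.norm_def, map_add,
      ← ENNReal.toReal_add hF.ne hG.ne]
    exact ENNReal.toReal_mono (ENNReal.add_lt_top.mpr ⟨hF, hG⟩).ne
      (besovENorm_add_le p χ s _ _)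

/-- The Besov norm. It vanishes only at the class of polynomials, that is at zero, but only the
topology that it defines matters here, so that this fact is not needed. -/
instance : SeminormedAddCommGroup (BesovSpace p χ s) :=
  SeminormedAddCommGroup.ofCore (BesovSpace.core p χ s)

instance : NormedSpace ℂ (BesovSpace p χ s) where
  norm_smul_le c F := BesovSpace.norm_smul_le' p χ s c F

/-- The intersection of `𝓢'_h` with the Besov space: the classes in the Besov space that have a
representative in `𝓢'_h`. -/
def homogeneousPart : Submodule ℂ (BesovSpace p χ s) :=
  ((homogeneousDistributions χ).map (polynomials d).mkQ).comap (BesovSpace.incl p χ s)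

/-- The closure `C^s_p` of this intersection in the topology of the Besov norm. -/
def homogeneousClosure : Submodule ℂ (BesovSpace p χ s) :=
  (homogeneousPart p χ s).topologicalClosure

end Besov

end HomBesov

end

namespace HomBesov

/-! ### An abstract form of the theorem of Phillips -/

section Phillips

open scoped BoundedContinuousFunction

/-! The argument transfers Phillips' theorem, that `c₀` is not complemented in `ℓ^∞`, to the low
frequencies of the Besov space. Put `σ = d/p`. A profile with Fourier support in an annulus is
rescaled to frequencies `2^(m k)`, with `m k` lacunary and tending to `-∞`, and normalized by `w k =
2^(m k (σ - s))`. Bounded superpositions of these pieces give a bounded map `T` from `ℓ^∞` to the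
Besov space (`exists_lacunary_embedding`). Each piece has a representative in `𝓢'_h`.

The series must converge in `𝓢'`, although the weights may grow. `exists_flat_profile` supplies a
profile equal to `1` to order `N` at the origin. Subtracting the constant `1` does not change the
class and leaves pieces of size `w k * 2^(N * m k) * ‖x‖^N`, which are summable for `N` large.

The coefficients are read off by pairing the Fourier transform with the symbol of one block near
each `2^(m k)`. After normalization these functionals are uniformly bounded by Hölder and scaling
(`enorm_blockFunctional_le`). On `𝓢'_h` the unnormalized pairings tend to `0` at low frequency
(`tendsto_blockFunctional_of_homogeneous`). The condition `s ≥ d/p` enters only here: it makes `w k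
≥ 1`, so that dividing by `w k` preserves the limit.

A projection onto the closure would then contradict Whitley's form of Phillips' theorem
(`not_closedComplemented_of_rightInverse`): for some infinite set `A` from an uncountable almost
disjoint family, the functionals would take on the projection of `T 1_A` the values `1_A(n)`, which
do not tend to `0`. -/

/-- The indicator function of a set of natural numbers, as a bounded sequence. -/
noncomputable def indicatorSeq (S : Set ℕ) : ℕ →ᵇ ℂ :=
  BoundedContinuousFunction.ofNormedAddCommGroupDiscrete (S.indicator 1) 1 fun n => by
    by_cases h : n ∈ S <;> simp [h]

theorem indicatorSeq_apply (S : Set ℕ) (n : ℕ) : indicatorSeq S n = S.indicator 1 n := rfl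

theorem indicatorSeq_diff_add_inter (S B : Set ℕ) :
    indicatorSeq (S \ B) + indicatorSeq (S ∩ B) = indicatorSeq S := by
  ext n
  by_cases h : n ∈ S <;> by_cases h' : n ∈ B <;> simp [indicatorSeq_apply, h, h']

theorem apply_indicatorSeq_of_finite (q : (ℕ →ᵇ ℂ) →L[ℂ] ℂ)
    (hq : ∀ k, q (indicatorSeq {k}) = 0) {S : Set ℕ} (hS : S.Finite) : q (indicatorSeq S) = 0 := by
  have h : indicatorSeq S = ∑ k ∈ hS.toFinset, indicatorSeq {k} := by
    ext n
    rw [BoundedContinuousFunction.sum_apply]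
    by_cases h : n ∈ S <;>
      simp [indicatorSeq_apply, Set.indicator_apply, h]
  rw [h, map_sum]
  exact Finset.sum_eq_zero fun k _ => hq k

theorem apply_indicatorSeq_diff (q : (ℕ →ᵇ ℂ) →L[ℂ] ℂ)
    (hq : ∀ k, q (indicatorSeq {k}) = 0) (S : Set ℕ) {B : Set ℕ} (hB : B.Finite) :
    q (indicatorSeq (S \ B)) = q (indicatorSeq S) := by
  rw [← indicatorSeq_diff_add_inter S B, map_add,
    apply_indicatorSeq_of_finite q hq (hB.subset Set.inter_subset_right), add_zero]

/-- A bounded functional on bounded sequences that vanishes on finitely supported sequences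
vanishes on all but countably many members of an almost disjoint family. -/
theorem countable_apply_indicatorSeq_ne_zero (q : (ℕ →ᵇ ℂ) →L[ℂ] ℂ)
    (hq : ∀ k, q (indicatorSeq {k}) = 0)
    {ι : Type*} (A : ι → Set ℕ)
    (hA : ∀ i j, i ≠ j → (A i ∩ A j).Finite) :
    {i | q (indicatorSeq (A i)) ≠ 0}.Countable := by
  classical
  have key : Summable fun i => ‖q (indicatorSeq (A i))‖ := by
    refine summable_of_sum_le (c := ‖q‖) (fun _ => norm_nonneg _) fun F => ?_
    -- Removing the finite set `B` of all pairwise overlaps makes the sets `A i` with `i ∈ F`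
    -- disjoint and does not change the values of `q`.
    set B : Set ℕ := ⋃ i ∈ F, ⋃ j ∈ F, if i = j then ∅ else A i ∩ A j with hB
    have hBfin : B.Finite := by
      refine F.finite_toSet.biUnion fun i _ => F.finite_toSet.biUnion fun j _ => ?_
      split_ifs with h
      · exact Set.finite_empty
      · exact hA i j h
    have hθ : ∀ z : ℂ, ∃ θ : ℂ, ‖θ‖ ≤ 1 ∧ θ * z = (‖z‖ : ℂ) := by
      intro z
      rcases eq_or_ne z 0 with rfl | hz
      · exact ⟨0, by simp⟩
      · refine ⟨(‖z‖ : ℂ) / z, ?_, by field_simp⟩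
        rw [norm_div, Complex.norm_real, norm_norm, div_self (norm_ne_zero_iff.mpr hz)]
    choose θ hθ1 hθ2 using hθ
    -- Disjointness keeps the norm of this combination at most `1`, while the phases align all
    -- values of `q`. Hence `∑ ‖q(1_{A i})‖ ≤ ‖q‖`.
    set x : ℕ →ᵇ ℂ := ∑ i ∈ F, θ (q (indicatorSeq (A i))) • indicatorSeq (A i \ B) with hx
    have hxn : ‖x‖ ≤ 1 := by
      refine (BoundedContinuousFunction.norm_le zero_le_one).mpr fun n => ?_
      rw [hx, BoundedContinuousFunction.sum_apply]
      by_cases h : ∃ i ∈ F, n ∈ A i \ B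
      · obtain ⟨i, hi, hn⟩ := h
        rw [Finset.sum_eq_single_of_mem i hi]
        · simpa [indicatorSeq_apply, hn.1, hn.2] using hθ1 _
        · intro j hj hji
          have : n ∉ A j \ B := by
            intro hnj
            apply hn.2
            simp only [hB, Set.mem_iUnion]
            exact ⟨j, hj, i, hi, by rw [if_neg hji]; exact ⟨hnj.1, hn.1⟩⟩
          simp [indicatorSeq_apply, Set.indicator_of_notMem this]
      · push Not at h
        rw [Finset.sum_eq_zero]
        · simp
        · intro i hi
          simp [indicatorSeq_apply, Set.indicator_of_notMem (h i hi)]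
    have hqx : q x = ((∑ i ∈ F, ‖q (indicatorSeq (A i))‖ : ℝ) : ℂ) := by
      rw [hx, map_sum, Complex.ofReal_sum]
      refine Finset.sum_congr rfl fun i _ => ?_
      rw [map_smul, apply_indicatorSeq_diff q hq _ hBfin, smul_eq_mul, hθ2]
    calc ∑ i ∈ F, ‖q (indicatorSeq (A i))‖ = ‖q x‖ := by
          rw [hqx, Complex.norm_real, Real.norm_of_nonneg (Finset.sum_nonneg fun _ _ => norm_nonneg _)]
      _ ≤ ‖q‖ * ‖x‖ := q.le_opNorm x
      _ ≤ ‖q‖ := mul_le_of_le_one_right (norm_nonneg _) hxn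
  refine key.countable_support.mono fun i hi => ?_
  simpa using hi

/-- An almost disjoint family of infinite sets of natural numbers, indexed by real numbers. -/
def floorSet (x : ℝ) : Set ℕ := Set.range fun n : ℕ => Encodable.encode (n, ⌊(n : ℝ) * x⌋)

theorem floorSet_infinite (x : ℝ) : (floorSet x).Infinite :=
  Set.infinite_range_of_injective fun m n h => by
    have := Encodable.encode_injective h
    exact (Prod.ext_iff.mp this).1

/-- A common element forces equal first coordinates `n` and equal floors of `n x` and `n y`, so `n
|x - y| < 1`, which bounds `n`. -/
theorem floorSet_inter_finite (x y : ℝ) (hxy : x ≠ y) : (floorSet x ∩ floorSet y).Finite := by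
  have hpos : 0 < |x - y| := abs_pos.mpr (sub_ne_zero.mpr hxy)
  refine ((Set.finite_Iio (⌈1 / |x - y|⌉₊ + 1)).image
    fun n : ℕ => Encodable.encode (n, ⌊(n : ℝ) * x⌋)).subset ?_
  rintro _ ⟨⟨n, rfl⟩, ⟨m, hm⟩⟩
  have h := Prod.ext_iff.mp (Encodable.encode_injective hm)
  obtain rfl : m = n := h.1
  refine ⟨m, ?_, rfl⟩
  have h1 : |(m : ℝ) * y - m * x| < 1 := Int.abs_sub_lt_one_of_floor_eq_floor h.2
  rw [← mul_sub, abs_mul, Nat.abs_cast, abs_sub_comm, ← lt_div_iff₀ hpos] at h1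
  exact Nat.lt_succ_of_lt (Nat.lt_of_lt_of_le (Nat.cast_lt.mp
    (h1.trans_le (Nat.le_ceil _))) le_rfl)

/-- A closed subspace that a bounded sequence of functionals sends to null sequences is not
complemented if these functionals have a bounded right inverse on bounded sequences that sends
finitely supported sequences to the subspace. -/
theorem not_closedComplemented_of_rightInverse {E : Type*} [SeminormedAddCommGroup E]
    [NormedSpace ℂ E] (H : Submodule ℂ E) (T : (ℕ →ᵇ ℂ) →L[ℂ] E) (l : ℕ → E →L[ℂ] ℂ) (K : ℝ)
    (hK : ∀ k x, ‖l k x‖ ≤ K * ‖x‖) (hH : ∀ x ∈ H, Tendsto (fun k => l k x) atTop (𝓝 0))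
    (hT : ∀ a k, l k (T a) = a k) (hsingle : ∀ k, T (indicatorSeq {k}) ∈ H) :
    ¬ H.topologicalClosure.ClosedComplemented := by
  rintro ⟨P, hP⟩
  -- The uniform bound on the functionals extends the null limit from `H` to its closure.
  have hC : ∀ x ∈ H.topologicalClosure, Tendsto (fun k => l k x) atTop (𝓝 0) := by
    intro x hx
    rw [Metric.tendsto_atTop]
    intro ε hε
    have hK' : 0 < |K| + 1 := by positivity
    obtain ⟨y, hy, hxy⟩ := Metric.mem_closure_iff.mp hx (ε / 2 / (|K| + 1)) (by positivity)
    obtain ⟨N, hN⟩ := Metric.tendsto_atTop.mp (hH y hy) (ε / 2) (by positivity)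
    refine ⟨N, fun n hn => ?_⟩
    have h1 := hN n hn
    rw [dist_zero_right] at h1 ⊢
    have h2 : ‖l n (x - y)‖ ≤ ε / 2 := by
      refine (hK n _).trans ?_
      rw [dist_eq_norm, lt_div_iff₀ hK'] at hxy
      nlinarith [norm_nonneg (x - y), le_abs_self K]
    calc ‖l n x‖ = ‖l n (x - y) + l n y‖ := by rw [← map_add, sub_add_cancel]
      _ ≤ ‖l n (x - y)‖ + ‖l n y‖ := norm_add_le _ _
      _ < ε := by linarith
  -- The defect `T - P T` vanishes on unit sequences, because `P` fixes their images under `T`.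
  let q : ℕ → (ℕ →ᵇ ℂ) →L[ℂ] ℂ := fun n =>
    (l n).comp (T - H.topologicalClosure.subtypeL.comp (P.comp T))
  have hqapp : ∀ n a, q n a = a n - l n (P (T a)) := by
    intro n a
    simp [q, hT]
  have hq : ∀ n k, q n (indicatorSeq {k}) = 0 := by
    intro n k
    have h := hP ⟨T (indicatorSeq {k}), H.le_topologicalClosure (hsingle k)⟩
    simp only at h
    rw [hqapp, h, hT, sub_self]
  -- Each `q n` excludes only countably many `x`, so one real `x` works for all `n` at once.
  have hcount : (⋃ n, {x : ℝ | q n (indicatorSeq (floorSet x)) ≠ 0}).Countable :=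
    Set.countable_iUnion fun n =>
      countable_apply_indicatorSeq_ne_zero (q n) (hq n) floorSet floorSet_inter_finite
  obtain ⟨x, hx⟩ : ∃ x : ℝ, x ∉ ⋃ n, {x : ℝ | q n (indicatorSeq (floorSet x)) ≠ 0} := by
    by_contra! h
    exact Cardinal.not_countable_real (hcount.mono fun x _ => h x)
  simp only [Set.mem_iUnion, not_exists, Set.mem_ofPred_eq, not_not] at hx
  have hlim := hC _ (P (T (indicatorSeq (floorSet x)))).2
  have heq : ∀ n, l n (P (T (indicatorSeq (floorSet x)))) = indicatorSeq (floorSet x) n := by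
    intro n
    have := hx n
    rw [hqapp, sub_eq_zero] at this
    exact this.symm
  simp only [heq] at hlim
  obtain ⟨N, hN⟩ := Metric.tendsto_atTop.mp hlim 1 one_pos
  obtain ⟨n, hn, hNn⟩ := (floorSet_infinite x).exists_gt N
  have := hN n hNn.le
  simp [indicatorSeq_apply, hn] at this

end Phillips

/-! ### Dilations -/

section Dilation

variable {d : ℕ}

/-- The dilation `h ↦ t^{-d} h(t^{-1} ·)` of Schwartz functions. -/
noncomputable def dilate (t : ℝ) (ht : 0 < t) : 𝓢(Rn d, ℂ) →L[ℂ] 𝓢(Rn d, ℂ) :=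
  (((t ^ d)⁻¹ : ℝ) : ℂ) •
    SchwartzMap.compCLMOfContinuousLinearEquiv ℂ
      (ContinuousLinearEquiv.smulLeft (R₁ := ℝ) (M₁ := Rn d) (Units.mk0 t ht.ne')⁻¹)

theorem dilate_apply (t : ℝ) (ht : 0 < t) (h : 𝓢(Rn d, ℂ)) (ξ : Rn d) :
    dilate t ht h ξ = (t ^ d)⁻¹ • h (t⁻¹ • ξ) := by
  simp only [dilate, smul_apply,
    SchwartzMap.compCLMOfContinuousLinearEquiv_apply, Function.comp_apply]
  rw [Complex.coe_smul]
  rfl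

theorem integral_dilation_smul (t : ℝ) (ht : 0 < t) (f : Rn d → ℂ) :
    ∫ ξ, (t ^ d)⁻¹ • f (t⁻¹ • ξ) = ∫ ξ, f ξ := by
  rw [integral_smul, Measure.integral_comp_inv_smul, finrank_euclideanSpace_fin,
    abs_of_pos (pow_pos ht d), smul_smul, inv_mul_cancel₀ (pow_pos ht d).ne', one_smul]

theorem fourierInv_dilate (t : ℝ) (ht : 0 < t) (h : 𝓢(Rn d, ℂ)) (x : Rn d) :
    (𝓕⁻ (dilate t ht h)) x = (𝓕⁻ h) (t • x) := by
  rw [SchwartzMap.fourierInv_coe, SchwartzMap.fourierInv_coe, Real.fourierInv_eq,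
    Real.fourierInv_eq, ← integral_dilation_smul t ht fun v => _ • h v]
  congr 1; funext v
  rw [dilate_apply, smul_comm, inner_smul_left, inner_smul_right]
  simp [ht.ne']

theorem fourier_dilate (t : ℝ) (ht : 0 < t) (h : 𝓢(Rn d, ℂ)) (x : Rn d) :
    (𝓕 (dilate t ht h)) x = (𝓕 h) (t • x) := by
  rw [SchwartzMap.fourier_coe, SchwartzMap.fourier_coe, Real.fourier_eq,
    Real.fourier_eq, ← integral_dilation_smul t ht fun v => _ • h v]
  congr 1; funext v
  rw [dilate_apply, smul_comm, inner_smul_left, inner_smul_right]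
  simp [ht.ne']

theorem eLpNorm_comp_dilation (t : ℝ) (ht : 0 < t) (f : Rn d → ℂ) (p : ℝ≥0∞) :
    eLpNorm (fun x => f (t • x)) p volume =
      ENNReal.ofReal (t ^ (-((d : ℝ) * (p⁻¹).toReal))) * eLpNorm f p volume := by
  have hemb : MeasurableEmbedding fun x : Rn d => t • x :=
    (Homeomorph.smulOfNeZero t ht.ne').measurableEmbedding
  have hc : 0 < (t ^ d)⁻¹ := inv_pos.mpr (pow_pos ht d)
  have h := hemb.eLpNorm_map_measure (g := f) (p := p) (μ := volume)
  rw [Measure.map_addHaar_smul _ ht.ne', finrank_euclideanSpace_fin, abs_of_pos hc,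
    eLpNorm_smul_measure_of_ne_zero (by simpa using pow_pos ht d)] at h
  change eLpNorm (f ∘ fun x => t • x) p volume = _
  rw [← h, smul_eq_mul, one_div, ENNReal.ofReal_rpow_of_pos hc, ← Real.rpow_natCast,
    ← Real.rpow_neg ht.le, ← Real.rpow_mul ht.le, neg_mul]

/-- With `z = e^{2πi⟨v,x⟩}`, the powers `z^(i+1)` correspond to dilations by `i + 1`. Omitting the
zeroth power keeps the frequency support away from the origin. -/
theorem sum_alternating_choose (N : ℕ) (z : ℂ) :
    ∑ i ∈ Finset.range N, (-1) ^ i * (N.choose (i + 1) : ℂ) * z ^ (i + 1) = 1 - (1 - z) ^ N := by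
  have h : (1 - z) ^ N = ∑ m ∈ Finset.range (N + 1), (-1) ^ m * (N.choose m : ℂ) * z ^ m := by
    rw [sub_eq_neg_add, add_pow]
    refine Finset.sum_congr rfl fun m _ => ?_
    rw [neg_pow]; ring
  rw [h, Finset.sum_range_succ']
  simp only [pow_succ, pow_zero, Nat.choose_zero_right, Nat.cast_one, mul_one]
  rw [sub_add_cancel_right, ← Finset.sum_neg_distrib]
  refine Finset.sum_congr rfl fun m _ => ?_
  ring

theorem norm_one_sub_fourierChar_le (y : ℝ) : ‖1 - (Real.fourierChar y : ℂ)‖ ≤ 2 * Real.pi * |y| := by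
  rw [norm_sub_rev, Real.fourierChar_apply, mul_comm _ Complex.I]
  refine Real.norm_exp_I_mul_ofReal_sub_one_le.trans_eq ?_
  rw [Real.norm_eq_abs, abs_mul, abs_of_pos Real.two_pi_pos]

/-- The combination of dilations of `h` that is the inverse Fourier transform of
`x ↦ ∑_i (-1)^i (N choose i+1) 𝓕⁻ h ((i+1) x)`. -/
noncomputable def flatten (N : ℕ) (h : 𝓢(Rn d, ℂ)) : 𝓢(Rn d, ℂ) :=
  ∑ i ∈ Finset.range N, ((-1) ^ i * (N.choose (i + 1) : ℂ)) • dilate (i + 1 : ℝ) (by positivity) h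

theorem fourierInv_flatten_sub_one (N : ℕ) (h : 𝓢(Rn d, ℂ)) (h1 : ∫ ξ, h ξ = 1) (x : Rn d) :
    (𝓕⁻ (flatten N h)) x - 1 =
      -∫ v, (1 - (Real.fourierChar (inner ℝ v x) : ℂ)) ^ N * h v := by
  have e1 : (𝓕⁻ (flatten N h)) x = ∑ i ∈ Finset.range N, ((-1) ^ i * (N.choose (i + 1) : ℂ)) *
      ∫ v, (Real.fourierChar (inner ℝ v x) : ℂ) ^ (i + 1) * h v := by
    have : (𝓕⁻ (flatten N h)) = ∑ i ∈ Finset.range N, ((-1) ^ i * (N.choose (i + 1) : ℂ)) •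
        𝓕⁻ (dilate (i + 1 : ℝ) (by positivity) h) := by
      rw [flatten, ← FourierTransform.fourierInvCLM_apply (R := ℂ), map_sum]
      simp
    rw [this, sum_apply]
    refine Finset.sum_congr rfl fun i _ => ?_
    rw [smul_apply, fourierInv_dilate, SchwartzMap.fourierInv_coe, Real.fourierInv_eq,
      smul_eq_mul]
    congr 2; funext v
    rw [inner_smul_right, Circle.smul_def, smul_eq_mul, ← Circle.coe_pow, ← AddChar.map_nsmul_eq_pow]
    simp
  have hint : ∀ i : ℕ,
      Integrable fun v => (Real.fourierChar (inner ℝ v x) : ℂ) ^ i * h v := by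
    intro i
    refine (h.integrable (μ := volume)).bdd_mul (c := 1) ?_ ?_
    · refine Continuous.aestronglyMeasurable ?_
      exact (continuous_subtype_val.comp (Real.continuous_fourierChar.comp (by fun_prop))).pow i
    · exact Eventually.of_forall fun v => by simp only [norm_pow, Circle.norm_coe, one_pow, le_refl]
  have hpow : Integrable fun v => (1 - (Real.fourierChar (inner ℝ v x) : ℂ)) ^ N * h v := by
    have := (h.integrable (μ := volume)).sub (integrable_finsetSum (Finset.range N) fun i _ =>
      (hint (i + 1)).const_mul ((-1) ^ i * (N.choose (i + 1) : ℂ)))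
    refine this.congr (Eventually.of_forall fun v => ?_)
    have := sum_alternating_choose N (Real.fourierChar (inner ℝ v x) : ℂ)
    simp only [Pi.sub_apply]
    simp_rw [← mul_assoc, ← Finset.sum_mul]
    rw [this]; ring
  suffices hsum : (𝓕⁻ (flatten N h)) x =
      ∫ v, (h v - (1 - (Real.fourierChar (inner ℝ v x) : ℂ)) ^ N * h v) by
    rw [integral_sub h.integrable hpow, h1] at hsum
    rw [hsum]; ring
  · rw [e1]
    simp_rw [← integral_const_mul]
    rw [← integral_finsetSum _ fun i _ => (hint _).const_mul _]
    congr 1; funext v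
    have := sum_alternating_choose N (Real.fourierChar (inner ℝ v x) : ℂ)
    simp_rw [← mul_assoc, ← Finset.sum_mul]
    rw [this]; ring

/-- Each of the `N` factors `1 - e^{2πi⟨v,x⟩}` is at most `2π ‖v‖ ‖x‖`; the powers of `‖v‖` are
absorbed by the decay of `h`. -/
theorem norm_fourierInv_flatten_sub_one_le (N : ℕ) (h : 𝓢(Rn d, ℂ)) (h1 : ∫ ξ, h ξ = 1) (x : Rn d) :
    ‖(𝓕⁻ (flatten N h)) x - 1‖ ≤ ((2 * Real.pi) ^ N * ∫ v, ‖v‖ ^ N * ‖h v‖) * ‖x‖ ^ N := by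
  rw [fourierInv_flatten_sub_one N h h1, norm_neg, mul_assoc, mul_comm _ (‖x‖ ^ N), ← mul_assoc,
    ← integral_const_mul]
  refine norm_integral_le_of_norm_le ((h.integrable_pow_mul volume N).const_mul _)
    (Eventually.of_forall fun v => ?_)
  rw [norm_mul, norm_pow, ← mul_assoc, ← mul_pow, ← mul_pow]
  gcongr
  refine (norm_one_sub_fourierChar_le _).trans ?_
  rw [mul_assoc (2 * Real.pi), mul_comm ‖x‖]
  refine mul_le_mul_of_nonneg_left ?_ (by positivity)
  exact abs_real_inner_le_norm v x

/-- There is a Schwartz function with integral `1` that is supported in an annulus. -/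
theorem exists_schwartz_annulus (hd : 0 < d) : ∃ h : 𝓢(Rn d, ℂ), ∫ ξ, h ξ = 1 ∧
    ∀ ξ, h ξ ≠ 0 → 1 / 2 ≤ ‖ξ‖ ∧ ‖ξ‖ ≤ 3 / 2 := by
  let e : Rn d := EuclideanSpace.single ⟨0, hd⟩ 1
  have he : ‖e‖ = 1 := by simp [e]
  let b : ContDiffBump e := ⟨1 / 4, 1 / 2, by norm_num, by norm_num⟩
  have hs : HasCompactSupport fun ξ => ((b.normed volume ξ : ℝ) : ℂ) :=
    b.hasCompactSupport_normed.comp_left (g := Complex.ofReal) rfl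
  have hc : ContDiff ℝ (⊤ : ℕ∞) fun ξ => ((b.normed volume ξ : ℝ) : ℂ) :=
    Complex.ofRealCLM.contDiff.comp b.contDiff_normed
  refine ⟨hs.toSchwartzMap hc, ?_, fun ξ hξ => ?_⟩
  · change ∫ ξ, ((b.normed volume ξ : ℝ) : ℂ) = 1
    rw [integral_complex_ofReal, b.integral_normed, Complex.ofReal_one]
  · have hm : ξ ∈ Function.support (b.normed volume) := by
      intro h0
      exact hξ (by simp [h0])
    rw [b.support_normed_eq, Metric.mem_ball, dist_eq_norm] at hm
    have hm' : ‖ξ - e‖ < 1 / 2 := hm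
    have h1 := norm_sub_norm_le ξ e
    have h2 := norm_sub_norm_le e ξ
    rw [norm_sub_rev] at h2
    constructor <;> linarith

theorem flatten_support (N : ℕ) (h : 𝓢(Rn d, ℂ))
    (hs : ∀ ξ, h ξ ≠ 0 → 1 / 2 ≤ ‖ξ‖ ∧ ‖ξ‖ ≤ 3 / 2) (ξ : Rn d) (hξ : flatten N h ξ ≠ 0) :
    1 / 2 ≤ ‖ξ‖ ∧ ‖ξ‖ ≤ 2 * N := by
  rw [flatten, sum_apply] at hξ
  obtain ⟨i, hi, hne⟩ := Finset.exists_ne_zero_of_sum_ne_zero hξ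
  rw [smul_apply, dilate_apply] at hne
  have hpos : (0 : ℝ) < i + 1 := by positivity
  have h0 := hs _ (right_ne_zero_of_smul (right_ne_zero_of_smul hne))
  rw [norm_smul, norm_inv, Real.norm_of_nonneg hpos.le, ← div_eq_inv_mul, le_div_iff₀ hpos,
    div_le_iff₀ hpos] at h0
  have hi' : (i : ℝ) + 1 ≤ N := by exact_mod_cast Finset.mem_range.mp hi
  have hi0 : (0 : ℝ) ≤ i := by positivity
  constructor <;> nlinarith

/-- For every order `N ≥ 1` there is a Schwartz function that is supported in an annulus and
whose inverse Fourier transform is equal to `1` to order `N` at the origin. -/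
theorem exists_flat_profile (hd : 0 < d) (N : ℕ) : ∃ (h : 𝓢(Rn d, ℂ)) (R : ℕ) (C : ℝ), 0 ≤ C ∧
    (∀ ξ, h ξ ≠ 0 → (2 : ℝ) ^ (-(R : ℤ)) ≤ ‖ξ‖ ∧ ‖ξ‖ ≤ (2 : ℝ) ^ (R : ℤ)) ∧
    ∀ x, ‖(𝓕⁻ h) x - 1‖ ≤ C * ‖x‖ ^ N := by
  obtain ⟨h, h1, hs⟩ := exists_schwartz_annulus hd
  refine ⟨flatten N h, N + 1, (2 * Real.pi) ^ N * ∫ v, ‖v‖ ^ N * ‖h v‖, ?_, fun ξ hξ => ?_,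
    norm_fourierInv_flatten_sub_one_le N h h1⟩
  · have : 0 ≤ ∫ v, ‖v‖ ^ N * ‖h v‖ := integral_nonneg fun v => by positivity
    positivity
  · obtain ⟨ha, hb⟩ := flatten_support N h hs ξ hξ
    constructor
    · refine le_trans ?_ ha
      rw [zpow_neg, zpow_natCast, one_div]
      gcongr
      exact le_self_pow₀ one_le_two (by omega)
    · refine hb.trans ?_
      rw [zpow_natCast, pow_succ, mul_comm]
      gcongr
      exact_mod_cast Nat.lt_two_pow_self.le

end Dilation
/-! ### Frequency localization -/

section Frequency

variable {d : ℕ} (χ : Cutoff d)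

theorem Cutoff.lowSymbol_eq_one {l : ℝ} (hl : 0 < l) {ξ : Rn d} (h : l * ‖ξ‖ ≤ 1) :
    χ.lowSymbol l ξ = 1 := by
  have h1 := χ.eq_one.self_of_nhdsSet (l • ξ) (by
    rwa [mem_closedBall_zero_iff, norm_smul, Real.norm_of_nonneg hl.le])
  simp [Cutoff.lowSymbol, h1]

theorem Cutoff.lowSymbol_eq_zero {l : ℝ} (hl : 0 < l) {ξ : Rn d} (h : 2 < l * ‖ξ‖) :
    χ.lowSymbol l ξ = 0 := by
  have h1 : χ.toFun (l • ξ) = 0 := by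
    by_contra hne
    have := χ.support_subset (subset_tsupport _ hne)
    rw [mem_closedBall_zero_iff, norm_smul, Real.norm_of_nonneg hl.le] at this
    exact h.not_ge this
  simp [Cutoff.lowSymbol, h1]

theorem Cutoff.norm_le_of_blockSymbol_ne_zero {j : ℤ} {ξ : Rn d} (h : χ.blockSymbol j ξ ≠ 0) :
    (2 : ℝ) ^ (j - 1) < ‖ξ‖ ∧ ‖ξ‖ ≤ (2 : ℝ) ^ (j + 1) := by
  have hl : (0 : ℝ) < 2 ^ (-j) := by positivity
  have hj : (2 : ℝ) ^ (-j) * 2 ^ j = 1 := by rw [← zpow_add₀ two_ne_zero]; simp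
  rw [χ.blockSymbol_eq, Pi.sub_apply] at h
  rw [zpow_sub_one₀ two_ne_zero, zpow_add_one₀ two_ne_zero]
  constructor
  · by_contra! hle
    refine h ?_
    have : 2 * (2 : ℝ) ^ (-j) * ‖ξ‖ ≤ 1 := by nlinarith
    rw [χ.lowSymbol_eq_one hl (by nlinarith [norm_nonneg ξ]),
      χ.lowSymbol_eq_one (by positivity) this, sub_self]
  · by_contra! hle
    refine h ?_
    have : 2 < (2 : ℝ) ^ (-j) * ‖ξ‖ := by nlinarith
    rw [χ.lowSymbol_eq_zero hl this, χ.lowSymbol_eq_zero (by positivity) (by nlinarith), sub_self]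

theorem Cutoff.blockSymbol_add (i m : ℤ) (ξ : Rn d) :
    χ.blockSymbol (i + m) ξ = χ.blockSymbol i (((2 : ℝ) ^ m)⁻¹ • ξ) := by
  simp only [Cutoff.blockSymbol]
  rw [smul_smul, neg_add, zpow_add₀ two_ne_zero, zpow_neg _ m]

/-- The symbol `ξ ↦ χ(l ξ)`, as a Schwartz function. -/
noncomputable def Cutoff.lowSchwartz (l : ℝ) (hl : 0 < l) : 𝓢(Rn d, ℂ) :=
  HasCompactSupport.toSchwartzMap (f := χ.lowSymbol l)
    (HasCompactSupport.intro (isCompact_closedBall (0 : Rn d) (2 / l)) fun ξ hξ =>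
      χ.lowSymbol_eq_zero hl (by
        rwa [mem_closedBall_zero_iff, not_le, div_lt_iff₀' hl] at hξ))
    (χ.lowSymbol_hasTemperateGrowth l).1

theorem Cutoff.lowSchwartz_apply (l : ℝ) (hl : 0 < l) (ξ : Rn d) :
    χ.lowSchwartz l hl ξ = χ.lowSymbol l ξ := rfl

/-- A Schwartz function that is equal to `1` on the support of the symbol of the block `j`. -/
noncomputable def Cutoff.blockPlateau (j : ℤ) : 𝓢(Rn d, ℂ) :=
  χ.lowSchwartz (2 ^ (-(j + 1))) (by positivity)

theorem Cutoff.blockPlateau_eq_one {j : ℤ} {ξ : Rn d} (h : ‖ξ‖ ≤ (2 : ℝ) ^ (j + 1)) :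
    χ.blockPlateau j ξ = 1 := by
  refine χ.lowSymbol_eq_one (by positivity) ?_
  rw [zpow_neg, inv_mul_le_iff₀ (by positivity), mul_one]
  exact h

theorem Cutoff.blockPlateau_eq_dilate (j : ℤ) :
    χ.blockPlateau j =
      (((((2 : ℝ) ^ j) ^ d : ℝ)) : ℂ) • dilate ((2 : ℝ) ^ j) (by positivity) (χ.blockPlateau 0) := by
  ext ξ
  have hj : ((2 : ℝ) ^ j) ^ d ≠ 0 := by positivity
  rw [smul_apply, dilate_apply, smul_eq_mul, Complex.real_smul, ← mul_assoc, ← Complex.ofReal_mul,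
    mul_inv_cancel₀ hj, Complex.ofReal_one, one_mul]
  simp only [Cutoff.blockPlateau, Cutoff.lowSchwartz_apply, Cutoff.lowSymbol]
  rw [smul_smul, neg_add, zpow_add₀ two_ne_zero, zpow_neg _ j, zero_add, mul_comm]

/-- The block `j` of a Schwartz function, on the Fourier side. -/
theorem smulLeft_blockSymbol_dilate (i m : ℤ) (h : 𝓢(Rn d, ℂ)) :
    SchwartzMap.smulLeftCLM ℂ (χ.blockSymbol (i + m)) (dilate ((2 : ℝ) ^ m) (by positivity) h) =
      dilate ((2 : ℝ) ^ m) (by positivity) (SchwartzMap.smulLeftCLM ℂ (χ.blockSymbol i) h) := by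
  ext ξ
  rw [SchwartzMap.smulLeftCLM_apply_apply (χ.blockSymbol_hasTemperateGrowth _), dilate_apply,
    dilate_apply, SchwartzMap.smulLeftCLM_apply_apply (χ.blockSymbol_hasTemperateGrowth _),
    χ.blockSymbol_add, smul_comm]

theorem smulLeft_blockSymbol_dilate_eq_zero {h : 𝓢(Rn d, ℂ)} {R : ℕ}
    (hR : ∀ ξ, h ξ ≠ 0 → (2 : ℝ) ^ (-(R : ℤ)) ≤ ‖ξ‖ ∧ ‖ξ‖ ≤ (2 : ℝ) ^ (R : ℤ)) {i : ℤ}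
    (hi : (R : ℤ) + 1 < |i|) :
    SchwartzMap.smulLeftCLM ℂ (χ.blockSymbol i) h = 0 := by
  ext ξ
  rw [SchwartzMap.smulLeftCLM_apply_apply (χ.blockSymbol_hasTemperateGrowth _), zero_apply,
    smul_eq_zero]
  by_contra! hne
  obtain ⟨h1, h2⟩ := χ.norm_le_of_blockSymbol_ne_zero hne.1
  obtain ⟨h3, h4⟩ := hR ξ hne.2
  have ha := (zpow_lt_zpow_iff_right₀ (one_lt_two (α := ℝ))).mp (h1.trans_le h4)
  have hb := (zpow_le_zpow_iff_right₀ (one_lt_two (α := ℝ))).mp (h3.trans h2)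
  have : |i| ≤ R + 1 := abs_le.mpr ⟨by omega, by omega⟩
  omega

/-- Some block of a function of integral `1` supported in an annulus has nonzero integral. -/
theorem exists_integral_block_ne_zero {h : 𝓢(Rn d, ℂ)} {R : ℕ}
    (hR : ∀ ξ, h ξ ≠ 0 → (2 : ℝ) ^ (-(R : ℤ)) ≤ ‖ξ‖ ∧ ‖ξ‖ ≤ (2 : ℝ) ^ (R : ℤ))
    (h1 : ∫ ξ, h ξ = 1) :
    ∃ i : ℤ, ∫ ξ, SchwartzMap.smulLeftCLM ℂ (χ.blockSymbol i) h ξ ≠ 0 := by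
  by_contra! hzero
  -- Telescoping: block integrals are differences of consecutive `I n`, so if all vanish then `I` is
  -- constant. But `χ(2^n ξ)` is `1` on the support of `h` at `n = -R` and `0` there at `n = R + 2`.
  let I : ℤ → ℂ := fun n => ∫ ξ, SchwartzMap.smulLeftCLM ℂ (χ.lowSymbol ((2 : ℝ) ^ n)) h ξ
  have hstep : ∀ n, I (n + 1) = I n := by
    intro n
    have := hzero (-n)
    rw [χ.blockSymbol_eq, SchwartzMap.smulLeftCLM_sub (χ.lowSymbol_hasTemperateGrowth _)
      (χ.lowSymbol_hasTemperateGrowth _), neg_neg, ← zpow_one_add₀ two_ne_zero] at this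
    have h2 : I n - I (1 + n) = 0 := by
      rw [← this, ← integral_sub (SchwartzMap.integrable _) (SchwartzMap.integrable _)]
      rfl
    rw [add_comm, ← sub_eq_zero.mp h2]
  have hconst : ∀ n : ℕ, I (-(R : ℤ) + n) = I (-(R : ℤ)) := by
    intro n
    induction n with
    | zero => simp
    | succ n ih => rw [← ih, ← hstep (-(R : ℤ) + n), Nat.cast_succ, add_assoc]
  have hlow : I (-(R : ℤ)) = 1 := by
    rw [← h1]
    refine integral_congr_ae (Eventually.of_forall fun ξ => ?_)
    rw [SchwartzMap.smulLeftCLM_apply_apply (χ.lowSymbol_hasTemperateGrowth _)]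
    by_cases hξ : h ξ = 0
    · simp [hξ]
    · rw [χ.lowSymbol_eq_one (by positivity), one_smul]
      rw [zpow_neg, inv_mul_le_iff₀ (by positivity), mul_one]
      exact (hR ξ hξ).2
  have hhigh : I (-(R : ℤ) + ((2 * R + 2 : ℕ) : ℤ)) = 0 := by
    refine integral_eq_zero_of_ae (Eventually.of_forall fun ξ => ?_)
    rw [SchwartzMap.smulLeftCLM_apply_apply (χ.lowSymbol_hasTemperateGrowth _)]
    by_cases hξ : h ξ = 0
    · simp [hξ]
    · rw [χ.lowSymbol_eq_zero (by positivity), zero_smul, Pi.zero_apply]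
      have hle := (hR ξ hξ).1
      calc (2 : ℝ) < 2 ^ (2 : ℤ) := by norm_num
        _ = 2 ^ (-(R : ℤ) + ((2 * R + 2 : ℕ) : ℤ)) * 2 ^ (-(R : ℤ)) := by
          rw [← zpow_add₀ two_ne_zero]; congr 1; push_cast; ring
        _ ≤ _ := by gcongr
  rw [hconst, hlow] at hhigh
  exact one_ne_zero hhigh

end Frequency

/-! ### Low frequency bumps -/

section Bump

variable {d : ℕ} (χ : Cutoff d)

theorem schwartzDistribution_apply (f u : 𝓢(Rn d, ℂ)) :
    SchwartzMap.toTemperedDistributionCLM (Rn d) ℂ volume f u = ∫ x, u x • f x :=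
  SchwartzMap.toTemperedDistributionCLM_apply_apply volume f u

/-- The inverse Fourier transform of a Schwartz function with a constant subtracted, as
a tempered distribution. -/
noncomputable def bump (h : 𝓢(Rn d, ℂ)) : 𝓢'(Rn d, ℂ) :=
  SchwartzMap.toTemperedDistributionCLM (Rn d) ℂ volume (𝓕⁻ h) - polyDistribution 1

/-- Dilation turns flatness of order `N` into a gain `t^N`, which will compensate the growing
weights at low frequency. -/
theorem norm_bump_dilate_apply_le {h : 𝓢(Rn d, ℂ)} {C : ℝ} {N : ℕ}
    (hC : ∀ x, ‖(𝓕⁻ h) x - 1‖ ≤ C * ‖x‖ ^ N) (t : ℝ) (ht : 0 < t) (u : 𝓢(Rn d, ℂ)) :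
    ‖bump (dilate t ht h) u‖ ≤ C * t ^ N * ∫ x, ‖x‖ ^ N * ‖u x‖ := by
  have hu := integrable_smul_polyFun u 1
  have hi : Integrable fun x => u x • (𝓕⁻ (dilate t ht h)) x := by
    have := (SchwartzMap.smulLeftCLM ℂ (𝓕⁻ (dilate t ht h) : 𝓢(Rn d, ℂ)) u).integrable (μ := volume)
    refine this.congr (Eventually.of_forall fun x => ?_)
    rw [SchwartzMap.smulLeftCLM_apply_apply (SchwartzMap.hasTemperateGrowth _), smul_eq_mul]
    exact mul_comm _ _
  rw [bump, sub_apply, schwartzDistribution_apply, polyDistribution_apply,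
    ← integral_sub hi hu, ← integral_const_mul]
  refine norm_integral_le_of_norm_le ((u.integrable_pow_mul volume N).const_mul _)
    (Eventually.of_forall fun x => ?_)
  rw [← smul_sub, fourierInv_dilate, norm_smul]
  have h1 := hC (t • x)
  rw [norm_smul, Real.norm_of_nonneg ht.le, mul_pow] at h1
  have h2 : polyFun 1 x = 1 := by simp [polyFun]
  rw [h2]
  calc ‖u x‖ * _ ≤ ‖u x‖ * (C * (t ^ N * ‖x‖ ^ N)) := by gcongr
    _ = _ := by ring

theorem dyadicBlock_bump (j : ℤ) (h : 𝓢(Rn d, ℂ)) :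
    dyadicBlock χ j (bump h) = SchwartzMap.toTemperedDistributionCLM (Rn d) ℂ volume
      (𝓕⁻ (SchwartzMap.smulLeftCLM ℂ (χ.blockSymbol j) h)) := by
  have hP : dyadicBlock χ j (polyDistribution 1) = 0 :=
    dyadicBlock_polynomial χ j (LinearMap.mem_range_self _ _)
  rw [bump, map_sub, hP, sub_zero, dyadicBlock,
    TemperedDistribution.fourierMultiplierCLM_toTemperedDistributionCLM_eq
      (χ.blockSymbol_hasTemperateGrowth j), SchwartzMap.fourierMultiplierCLM_apply,
    FourierTransform.fourier_fourierInv_eq]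

theorem mkQ_bump (h : 𝓢(Rn d, ℂ)) :
    (polynomials d).mkQ (bump h) =
      (polynomials d).mkQ (SchwartzMap.toTemperedDistributionCLM (Rn d) ℂ volume (𝓕⁻ h)) := by
  rw [bump, map_sub, sub_eq_self, Submodule.mkQ_apply, Submodule.Quotient.mk_eq_zero]
  exact LinearMap.mem_range_self _ _

/-- A Schwartz function whose Fourier transform vanishes near the origin is homogeneous. -/
theorem fourierInv_mem_homogeneousDistributions {h : 𝓢(Rn d, ℂ)} {r : ℝ} (hr : 0 < r)
    (hh : ∀ ξ, h ξ ≠ 0 → r ≤ ‖ξ‖) :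
    SchwartzMap.toTemperedDistributionCLM (Rn d) ℂ volume (𝓕⁻ h) ∈ homogeneousDistributions χ := by
  change Tendsto _ _ _
  refine tendsto_const_nhds.congr' ?_
  filter_upwards [eventually_gt_atTop (2 / r)] with l hl
  have hl0 : 0 < l := lt_trans (by positivity) hl
  ext u
  rw [TemperedDistribution.fourier_toTemperedDistributionCLM_eq,
    FourierTransform.fourier_fourierInv_eq, TemperedDistribution.smulLeftCLM_apply_apply,
    schwartzDistribution_apply, zero_apply]
  refine (integral_eq_zero_of_ae (Eventually.of_forall fun ξ => ?_)).symm
  rw [SchwartzMap.smulLeftCLM_apply_apply (χ.lowSymbol_hasTemperateGrowth l)]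
  by_cases hξ : h ξ = 0
  · simp [hξ]
  · rw [χ.lowSymbol_eq_zero hl0]
    · simp
    · rw [div_lt_iff₀ hr] at hl
      exact hl.trans_le (by gcongr; exact hh ξ hξ)

open scoped BoundedContinuousFunction

/-- Superposition of a sequence of distributions with bounded coefficients. -/
theorem exists_superposition (e : ℕ → 𝓢'(Rn d, ℂ)) (b : ℕ → ℝ) (hb : Summable b) (N : ℕ)
    (he : ∀ k u, ‖e k u‖ ≤ b k * ∫ x, ‖x‖ ^ N * ‖u x‖) :
    ∃ S : (ℕ →ᵇ ℂ) →ₗ[ℂ] 𝓢'(Rn d, ℂ), ∀ a u, HasSum (fun k => a k * e k u) (S a u) := by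
  have hbd : ∀ (a : ℕ →ᵇ ℂ) u k, ‖a k * e k u‖ ≤ ‖a‖ * (b k * ∫ x, ‖x‖ ^ N * ‖u x‖) := by
    intro a u k
    rw [norm_mul]
    exact mul_le_mul (a.norm_coe_le_norm k) (he k u) (norm_nonneg _) (norm_nonneg _)
  have hmaj : ∀ (a : ℕ →ᵇ ℂ) (u : 𝓢(Rn d, ℂ)),
      Summable fun k => ‖a‖ * (b k * ∫ x, ‖x‖ ^ N * ‖u x‖) := fun a u =>
    (hb.mul_right _).mul_left _
  have hsum : ∀ (a : ℕ →ᵇ ℂ) u, Summable fun k => a k * e k u := fun a u =>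
    Summable.of_norm_bounded (hmaj a u) (hbd a u)
  -- For this `n` the weight `(1 + ‖x‖)^(-n)` is integrable, so the moment of order `N` of `u` is
  -- bounded by two Schwartz seminorms. This gives continuity of the sum in `u`.
  let n := (volume : Measure (Rn d)).integrablePower
  let D : ℝ := 2 ^ n * ∫ x : Rn d, (1 + ‖x‖) ^ (-(n : ℝ))
  have hD : 0 ≤ D := mul_nonneg (by positivity) (integral_nonneg fun x => by positivity)
  have hint : ∀ u : 𝓢(Rn d, ℂ), ∫ x, ‖x‖ ^ N * ‖u x‖ ≤
      D * 2 * ({(0, 0), (N + n, 0)} : Finset (ℕ × ℕ)).sup (schwartzSeminormFamily ℂ (Rn d) ℂ) u := by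
    intro u
    have h := u.integral_pow_mul_iteratedFDeriv_le ℂ (μ := volume) N 0
    simp only [norm_iteratedFDeriv_zero] at h
    refine h.trans ?_
    rw [mul_assoc D, two_mul]
    refine mul_le_mul_of_nonneg_left (add_le_add ?_ ?_) hD
    · exact Seminorm.le_def.mp (Finset.le_sup (f := schwartzSeminormFamily ℂ (Rn d) ℂ)
        (show ((0 : ℕ), (0 : ℕ)) ∈ ({(0, 0), (N + n, 0)} : Finset (ℕ × ℕ)) by simp)) u
    · exact Seminorm.le_def.mp (Finset.le_sup (f := schwartzSeminormFamily ℂ (Rn d) ℂ)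
        (show (N + n, (0 : ℕ)) ∈ ({(0, 0), (N + n, 0)} : Finset (ℕ × ℕ)) by simp)) u
  have hb0 : ∀ k (u : 𝓢(Rn d, ℂ)), 0 ≤ b k * ∫ x, ‖x‖ ^ N * ‖u x‖ := fun k u =>
    (norm_nonneg _).trans (he k u)
  let L : (ℕ →ᵇ ℂ) → (𝓢(Rn d, ℂ) →L[ℂ] ℂ) := fun a =>
    SchwartzMap.mkCLMtoNormedSpace (𝕜 := ℂ) (σ := RingHom.id ℂ) (fun u => ∑' k, a k * e k u)
      (fun u v => by
        rw [← (hsum a u).tsum_add (hsum a v)]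
        simp only [map_add, mul_add])
      (fun c u => by
        rw [RingHom.id_apply, smul_eq_mul, ← tsum_mul_left]
        simp only [map_smul, smul_eq_mul, mul_left_comm])
      ⟨{(0, 0), (N + n, 0)}, ‖a‖ * (∑' k, |b k|) * (D * 2), by positivity, fun u => by
        refine (tsum_of_norm_bounded (hmaj a u).hasSum (hbd a u)).trans ?_
        rw [tsum_mul_left, tsum_mul_right, mul_assoc, mul_assoc, mul_assoc, ← mul_assoc D]
        refine mul_le_mul_of_nonneg_left ?_ (norm_nonneg a)
        refine mul_le_mul (hb.tsum_le_tsum (fun k => le_abs_self _) hb.abs) (hint u) ?_ ?_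
        · exact integral_nonneg fun x => by positivity
        · exact tsum_nonneg fun k => abs_nonneg _⟩
  refine ⟨{ toFun := fun a => ContinuousLinearMap.toPointwiseConvergenceCLM _ _ _ _ (L a)
            map_add' := fun a a' => ?_
            map_smul' := fun c a => ?_ }, fun a u => (hsum a u).hasSum⟩
  · ext u
    change ∑' k, (a + a') k * e k u = ∑' k, a k * e k u + ∑' k, a' k * e k u
    rw [← (hsum a u).tsum_add (hsum a' u)]
    simp only [BoundedContinuousFunction.add_apply, add_mul]
  · ext u
    change ∑' k, (c • a) k * e k u = c * ∑' k, a k * e k u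
    rw [← tsum_mul_left]
    simp only [BoundedContinuousFunction.smul_apply, smul_eq_mul, mul_assoc]

end Bump
/-! ### Norm estimates -/

section Estimates

variable {d : ℕ} (χ : Cutoff d) (p : ℝ≥0∞) [Fact (1 ≤ p)] (s : ℝ)

theorem distLpNorm_schwartz (f : 𝓢(Rn d, ℂ)) :
    distLpNorm p (SchwartzMap.toTemperedDistributionCLM (Rn d) ℂ volume f) =
      eLpNorm f p volume := by
  rw [← Lp.toTemperedDistribution_toLp_eq (p := p), distLpNorm_toTemperedDistribution,
    Lp.enorm_def, eLpNorm_congr_ae (f.coeFn_toLp p volume)]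

/-- Hölder's inequality. The exponent `(1 - p⁻¹)⁻¹` is the conjugate of `p` also at the endpoints:
`∞` for `p = 1` and `1` for `p = ∞`. -/
theorem enorm_apply_le_distLpNorm (T : 𝓢'(Rn d, ℂ)) (hT : distLpNorm p T < ∞) (u : 𝓢(Rn d, ℂ)) :
    ‖T u‖ₑ ≤ distLpNorm p T * eLpNorm u (1 - p⁻¹)⁻¹ volume := by
  obtain ⟨g, rfl⟩ := exists_of_distLpNorm_lt_top p hT
  have := ENNReal.HolderConjugate.inv_one_sub_inv' (Fact.out : 1 ≤ p)
  rw [distLpNorm_toTemperedDistribution, Lp.toTemperedDistribution_apply, Lp.enorm_def, mul_comm]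
  have hsymm : ENNReal.HolderTriple (1 - p⁻¹)⁻¹ p 1 := inferInstance
  calc ‖∫ x, u x • g x‖ₑ ≤ eLpNorm ((u : Rn d → ℂ) • (g : Rn d → ℂ)) 1 volume := by
        rw [eLpNorm_one_eq_lintegral_enorm]
        exact enorm_integral_le_lintegral_enorm _
    _ ≤ _ := eLpNorm_smul_le_mul_eLpNorm (Lp.aestronglyMeasurable g)
        u.continuous.aestronglyMeasurable

theorem toReal_inv_inv_one_sub : (((1 - p⁻¹)⁻¹)⁻¹).toReal = 1 - (p⁻¹).toReal := by
  rw [inv_inv, ENNReal.toReal_sub_of_le (ENNReal.inv_le_one.mpr Fact.out) ENNReal.one_ne_top,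
    ENNReal.toReal_one]

theorem eLpNorm_fourier_blockPlateau (j : ℤ) (q : ℝ≥0∞) :
    eLpNorm (𝓕 (χ.blockPlateau j) : 𝓢(Rn d, ℂ)) q volume =
      ENNReal.ofReal ((2 : ℝ) ^ ((j : ℝ) * (d * (1 - (q⁻¹).toReal)))) *
        eLpNorm (𝓕 (χ.blockPlateau 0) : 𝓢(Rn d, ℂ)) q volume := by
  have h2 : (0 : ℝ) < 2 ^ j := by positivity
  have h : ((𝓕 (χ.blockPlateau j) : 𝓢(Rn d, ℂ)) : Rn d → ℂ) =
      ((((2 : ℝ) ^ j) ^ d : ℝ) : ℂ) •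
        fun x => (𝓕 (χ.blockPlateau 0) : 𝓢(Rn d, ℂ)) (((2 : ℝ) ^ j) • x) := by
    funext x
    rw [χ.blockPlateau_eq_dilate j, FourierTransform.fourier_smul, Pi.smul_apply, ← fourier_dilate _ h2]
    rfl
  rw [h, eLpNorm_const_smul, eLpNorm_comp_dilation _ h2, ← mul_assoc]
  congr 1
  rw [← ofReal_norm, Complex.norm_real, Real.norm_of_nonneg (by positivity),
    ← ENNReal.ofReal_mul (by positivity), ← Real.rpow_intCast, ← Real.rpow_natCast,
    ← Real.rpow_mul zero_le_two, ← Real.rpow_mul zero_le_two, ← Real.rpow_add two_pos]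
  congr 2; ring

/-- The evaluation of the Fourier transform at the symbol of a block, as a functional on
distributions modulo polynomials. -/
noncomputable def blockFunctional (j : ℤ) : DistModPoly d →ₗ[ℂ] ℂ where
  toFun F := dyadicBlockMod χ j F (𝓕 (χ.blockPlateau j))
  map_add' F G := by rw [map_add]; rfl
  map_smul' c F := by rw [map_smul]; rfl

theorem blockFunctional_apply (j : ℤ) (F : DistModPoly d) :
    blockFunctional χ j F = dyadicBlockMod χ j F (𝓕 (χ.blockPlateau j)) := rfl

/-- The plateau allows testing the block against a Schwartz function without changing the pairing of
the Fourier transform with the symbol. Its conjugate norm scales as `2^(j d/p)`, and the Besov norm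
contributes `2^(-j s)`. -/
theorem enorm_blockFunctional_le (j : ℤ) (F : DistModPoly d) (hF : besovENorm p χ s F < ∞) :
    ‖blockFunctional χ j F‖ₑ ≤
      eLpNorm (𝓕 (χ.blockPlateau 0) : 𝓢(Rn d, ℂ)) (1 - p⁻¹)⁻¹ volume *
        ENNReal.ofReal ((2 : ℝ) ^ ((j : ℝ) * (d * (p⁻¹).toReal - s))) * besovENorm p χ s F := by
  have h2 : ENNReal.ofReal ((2 : ℝ) ^ ((j : ℝ) * s)) * distLpNorm p (dyadicBlockMod χ j F) ≤
      besovENorm p χ s F :=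
    le_iSup (fun m : ℤ => ENNReal.ofReal ((2 : ℝ) ^ ((m : ℝ) * s)) *
      distLpNorm p (dyadicBlockMod χ m F)) j
  have h1 := enorm_apply_le_distLpNorm p _ (distLpNorm_lt_top_of_besovENorm p χ s hF j)
    (𝓕 (χ.blockPlateau j))
  rw [eLpNorm_fourier_blockPlateau, toReal_inv_inv_one_sub, sub_sub_cancel] at h1
  rw [blockFunctional_apply]
  refine h1.trans ?_
  have h3 : (2 : ℝ) ^ ((j : ℝ) * (d * (p⁻¹).toReal)) =
      2 ^ ((j : ℝ) * (d * (p⁻¹).toReal - s)) * 2 ^ ((j : ℝ) * s) := by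
    rw [← Real.rpow_add two_pos]; congr 1; ring
  rw [h3, ENNReal.ofReal_mul (by positivity)]
  calc _ = eLpNorm (𝓕 (χ.blockPlateau 0) : 𝓢(Rn d, ℂ)) (1 - p⁻¹)⁻¹ volume *
        ENNReal.ofReal ((2 : ℝ) ^ ((j : ℝ) * (d * (p⁻¹).toReal - s))) *
        (ENNReal.ofReal ((2 : ℝ) ^ ((j : ℝ) * s)) * distLpNorm p (dyadicBlockMod χ j F)) := by ring
    _ ≤ _ := by gcongr

/-- A block symbol is the difference of two low-frequency cutoffs. For `j ≤ -1` the moving plateau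
can be replaced by the fixed one at `-1`, to which the definition of `𝓢'_h` applies. -/
theorem tendsto_blockFunctional_of_homogeneous {f : 𝓢'(Rn d, ℂ)}
    (hf : f ∈ homogeneousDistributions χ) :
    Tendsto (fun j : ℤ => blockFunctional χ j ((polynomials d).mkQ f)) atBot (𝓝 0) := by
  have hf' : Tendsto (fun l : ℝ => TemperedDistribution.smulLeftCLM ℂ (χ.lowSymbol l) (𝓕 f)
      (χ.blockPlateau (-1))) atTop (𝓝 0) := by
    have hev : Continuous fun T : 𝓢'(Rn d, ℂ) => T (χ.blockPlateau (-1)) :=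
      continuous_eval_const _
    exact (hev.tendsto 0).comp hf
  have h1 : Tendsto (fun j : ℤ => (2 : ℝ) ^ (-j)) atBot atTop :=
    (tendsto_atTop_atTop_of_monotone (zpow_right_mono₀ one_le_two) fun b =>
      let ⟨n, hn⟩ := pow_unbounded_of_one_lt b (one_lt_two (α := ℝ))
      ⟨n, by rw [zpow_natCast]; exact hn.le⟩).comp tendsto_neg_atBot_atTop
  have h2 := (hf'.comp h1).sub (hf'.comp (h1.const_mul_atTop two_pos))
  rw [sub_zero] at h2
  refine h2.congr' ?_
  filter_upwards [eventually_le_atBot (-1)] with j hj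
  have hjj : (2 : ℝ) ^ (j + 1) ≤ 2 ^ (-1 + 1 : ℤ) :=
    zpow_le_zpow_right₀ one_le_two (by omega)
  rw [blockFunctional_apply]
  change _ = f (𝓕 (SchwartzMap.smulLeftCLM ℂ (χ.blockSymbol j) (𝓕⁻ (𝓕 (χ.blockPlateau j)))))
  rw [FourierTransform.fourierInv_fourier_eq]
  change 𝓕 f (SchwartzMap.smulLeftCLM ℂ (χ.lowSymbol (2 ^ (-j))) (χ.blockPlateau (-1))) -
    𝓕 f (SchwartzMap.smulLeftCLM ℂ (χ.lowSymbol (2 * 2 ^ (-j))) (χ.blockPlateau (-1))) =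
    𝓕 f (SchwartzMap.smulLeftCLM ℂ (χ.blockSymbol j) (χ.blockPlateau j))
  rw [← map_sub]
  congr 1
  ext ξ
  rw [sub_apply, SchwartzMap.smulLeftCLM_apply_apply (χ.lowSymbol_hasTemperateGrowth _),
    SchwartzMap.smulLeftCLM_apply_apply (χ.lowSymbol_hasTemperateGrowth _),
    SchwartzMap.smulLeftCLM_apply_apply (χ.blockSymbol_hasTemperateGrowth _), ← sub_smul]
  change (χ.lowSymbol (2 ^ (-j)) - χ.lowSymbol (2 * 2 ^ (-j))) ξ • _ = _
  rw [← χ.blockSymbol_eq]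
  by_cases hξ : χ.blockSymbol j ξ = 0
  · simp [hξ]
  · have hn := (χ.norm_le_of_blockSymbol_ne_zero hξ).2
    rw [χ.blockPlateau_eq_one hn, χ.blockPlateau_eq_one (hn.trans hjj)]

/-- The Besov norm of rescaled functions. -/
theorem besov_dyadicBlock_bump (h : 𝓢(Rn d, ℂ)) (i m : ℤ) :
    ENNReal.ofReal ((2 : ℝ) ^ (((i + m : ℤ) : ℝ) * s)) *
      distLpNorm p (dyadicBlock χ (i + m) (bump (dilate ((2 : ℝ) ^ m) (by positivity) h))) =
    ENNReal.ofReal ((2 : ℝ) ^ ((m : ℝ) * (s - d * (p⁻¹).toReal))) *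
      (ENNReal.ofReal ((2 : ℝ) ^ ((i : ℝ) * s)) *
        eLpNorm (𝓕⁻ (SchwartzMap.smulLeftCLM ℂ (χ.blockSymbol i) h) : 𝓢(Rn d, ℂ)) p volume) := by
  have h2 : (0 : ℝ) < 2 ^ m := by positivity
  rw [dyadicBlock_bump, distLpNorm_schwartz, smulLeft_blockSymbol_dilate]
  have e : ((𝓕⁻ (dilate ((2 : ℝ) ^ m) h2 (SchwartzMap.smulLeftCLM ℂ (χ.blockSymbol i) h)) :
      𝓢(Rn d, ℂ)) : Rn d → ℂ) = fun x => (𝓕⁻ (SchwartzMap.smulLeftCLM ℂ (χ.blockSymbol i) h) :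
      𝓢(Rn d, ℂ)) (((2 : ℝ) ^ m) • x) := funext fun x => fourierInv_dilate _ h2 _ x
  rw [e, eLpNorm_comp_dilation _ h2, ← mul_assoc, ← mul_assoc,
    ← ENNReal.ofReal_mul (by positivity), ← ENNReal.ofReal_mul (by positivity)]
  congr 2
  rw [← Real.rpow_intCast, ← Real.rpow_mul zero_le_two, ← Real.rpow_add two_pos,
    ← Real.rpow_add two_pos]
  congr 1
  push_cast; ring

/-- The plateau is `1` on the block, and the `L¹` normalization of `dilate` makes the value
independent of `m`. This is the constant by which coefficients are recovered. -/
theorem dyadicBlock_bump_fourier_blockPlateau (h : 𝓢(Rn d, ℂ)) (i m : ℤ) :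
    dyadicBlock χ (i + m) (bump (dilate ((2 : ℝ) ^ m) (by positivity) h))
      (𝓕 (χ.blockPlateau (i + m))) =
    ∫ ξ, SchwartzMap.smulLeftCLM ℂ (χ.blockSymbol i) h ξ := by
  have h2 : (0 : ℝ) < 2 ^ m := by positivity
  rw [dyadicBlock_bump, ← TemperedDistribution.fourier_apply,
    TemperedDistribution.fourier_toTemperedDistributionCLM_eq,
    FourierTransform.fourier_fourierInv_eq, schwartzDistribution_apply,
    ← integral_dilation_smul _ h2 fun ξ => SchwartzMap.smulLeftCLM ℂ (χ.blockSymbol i) h ξ]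
  refine integral_congr_ae (Eventually.of_forall fun ξ => ?_)
  beta_reduce
  rw [← dilate_apply _ h2, ← smulLeft_blockSymbol_dilate,
    SchwartzMap.smulLeftCLM_apply_apply (χ.blockSymbol_hasTemperateGrowth _)]
  by_cases hξ : χ.blockSymbol (i + m) ξ = 0
  · simp [hξ]
  · rw [χ.blockPlateau_eq_one (χ.norm_le_of_blockSymbol_ne_zero hξ).2, one_smul]

end Estimates
/-! ### Lacunary series in the Besov space -/

section Lacunary

open scoped BoundedContinuousFunction

variable {d : ℕ} (χ : Cutoff d) (p : ℝ≥0∞) [Fact (1 ≤ p)] (s : ℝ)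

/-- Bounded lacunary superpositions of rescaled bumps form a copy of the space of bounded
sequences in the Besov space. -/
theorem exists_lacunary_embedding (hd : 0 < d) :
    ∃ (T : (ℕ →ᵇ ℂ) →L[ℂ] BesovSpace p χ s) (i : ℤ) (c : ℂ) (m : ℕ → ℤ), c ≠ 0 ∧
      (∀ k, m k ≤ 0) ∧ Tendsto m atTop atBot ∧
      (∀ k, T (indicatorSeq {k}) ∈ homogeneousPart p χ s) ∧
      ∀ a k, blockFunctional χ (i + m k) (BesovSpace.incl p χ s (T a)) =
        a k * (((2 : ℝ) ^ ((m k : ℝ) * (d * (p⁻¹).toReal - s)) : ℝ) * c) := by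
  set σ : ℝ := (d : ℝ) * (p⁻¹).toReal with hσ
  -- `N ≥ s - σ + 1` makes `w k * 2^(N * m k) ≤ 2^(m k) ≤ 2^(-k)`; `N ≠ 0` lets flatness at `x = 0`
  -- give integral `1`.
  obtain ⟨N, hN0, hN⟩ : ∃ N : ℕ, N ≠ 0 ∧ s - σ + 1 ≤ N :=
    ⟨⌈s - σ⌉₊ + 1, by omega, by push_cast; linarith [Nat.le_ceil (s - σ)]⟩
  obtain ⟨h, R, C, hC0, hR, hC⟩ := exists_flat_profile hd N
  have h1 : ∫ ξ, h ξ = 1 := by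
    have h0 := hC 0
    rw [norm_zero, zero_pow hN0, mul_zero, norm_le_zero_iff, sub_eq_zero, SchwartzMap.fourierInv_coe,
      Real.fourierInv_eq] at h0
    simpa using h0
  obtain ⟨i, hi⟩ := exists_integral_block_ne_zero χ hR h1
  -- A piece meets only blocks within `R + 1` of `m k`; a spacing larger than `2R + 2` ensures that
  -- each block sees at most one piece.
  let m : ℕ → ℤ := fun k => -((2 * R + 4 : ℤ) * k)
  have hm : ∀ k, m k ≤ -(k : ℤ) := fun k => by
    simp only [m]; nlinarith [Int.natCast_nonneg k, Int.natCast_nonneg R]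
  let w : ℕ → ℝ := fun k => (2 : ℝ) ^ ((m k : ℝ) * (σ - s))
  have hw : ∀ k, 0 < w k := fun k => Real.rpow_pos_of_pos two_pos _
  let e : ℕ → 𝓢'(Rn d, ℂ) := fun k =>
    (w k : ℂ) • bump (dilate ((2 : ℝ) ^ m k) (by positivity) h)
  have he : ∀ k u, ‖e k u‖ ≤ C * (1 / 2) ^ k * ∫ x, ‖x‖ ^ N * ‖u x‖ := by
    intro k u
    have hb := norm_bump_dilate_apply_le hC ((2 : ℝ) ^ m k) (by positivity) u
    have hI : 0 ≤ ∫ x, ‖x‖ ^ N * ‖u x‖ := integral_nonneg fun x => by positivity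
    have hmk : (m k : ℝ) ≤ -(k : ℝ) := by exact_mod_cast hm k
    have hk0 : (0 : ℝ) ≤ k := by positivity
    have hwN : w k * ((2 : ℝ) ^ m k) ^ N ≤ (1 / 2) ^ k := by
      rw [← Real.rpow_intCast, ← Real.rpow_natCast, ← Real.rpow_mul zero_le_two,
        ← Real.rpow_add two_pos, one_div, inv_pow, ← Real.rpow_natCast, ← Real.rpow_neg zero_le_two]
      refine Real.rpow_le_rpow_of_exponent_le one_le_two ?_
      nlinarith
    calc ‖e k u‖ = w k * ‖bump (dilate ((2 : ℝ) ^ m k) (by positivity) h) u‖ := by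
          change ‖(w k : ℂ) • bump (dilate ((2 : ℝ) ^ m k) (by positivity) h) u‖ = _
          rw [norm_smul, Complex.norm_real, Real.norm_of_nonneg (hw k).le]
      _ ≤ w k * (C * ((2 : ℝ) ^ m k) ^ N * ∫ x, ‖x‖ ^ N * ‖u x‖) :=
          mul_le_mul_of_nonneg_left hb (hw k).le
      _ = C * (w k * ((2 : ℝ) ^ m k) ^ N) * ∫ x, ‖x‖ ^ N * ‖u x‖ := by ring
      _ ≤ _ := by gcongr
  obtain ⟨S, hS⟩ := exists_superposition e (fun k => C * (1 / 2) ^ k)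
    (summable_geometric_two.mul_left C) N he
  have hzero : ∀ j k, (R : ℤ) + 1 < |j - m k| → dyadicBlock χ j (e k) = 0 := by
    intro j k hjk
    have h0 : SchwartzMap.smulLeftCLM ℂ (χ.blockSymbol j)
        (dilate ((2 : ℝ) ^ m k) (by positivity) h) = 0 := by
      have := smulLeft_blockSymbol_dilate χ (j - m k) (m k) h
      rwa [smulLeft_blockSymbol_dilate_eq_zero χ hR hjk, map_zero, sub_add_cancel] at this
    simp only [e]
    rw [map_smul, dyadicBlock_bump, h0, FourierTransform.fourierInv_zero, map_zero]
    ext u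
    exact mul_zero (w k : ℂ)
  have hsep : ∀ j k k', |j - m k| ≤ (R : ℤ) + 1 → k' ≠ k → (R : ℤ) + 1 < |j - m k'| := by
    intro j k k' hjk hne
    by_contra! hjk'
    rw [abs_le] at hjk hjk'
    simp only [m] at hjk hjk'
    rcases lt_or_gt_of_ne hne with hlt | hlt
    · have : (k' : ℤ) + 1 ≤ k := by exact_mod_cast hlt
      nlinarith [Int.natCast_nonneg R]
    · have : (k : ℤ) + 1 ≤ k' := by exact_mod_cast hlt
      nlinarith [Int.natCast_nonneg R]
  have hblock : ∀ a j k, |j - m k| ≤ (R : ℤ) + 1 →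
      dyadicBlock χ j (S a) = a k • dyadicBlock χ j (e k) := by
    intro a j k hjk
    ext u
    refine (hS a _).unique (hasSum_single k fun k' hk' => ?_)
    have := congrArg (fun D : 𝓢'(Rn d, ℂ) => D u) (hzero j k' (hsep j k k' hjk hk'))
    exact mul_eq_zero_of_right _ this
  have hblock0 : ∀ a j, (∀ k, (R : ℤ) + 1 < |j - m k|) → dyadicBlock χ j (S a) = 0 := by
    intro a j hj
    ext u
    refine (hS a _).unique ?_
    refine Eq.subst (motive := fun f => HasSum f (0 : ℂ)) (funext fun k => ?_) hasSum_zero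
    have := congrArg (fun D : 𝓢'(Rn d, ℂ) => D u) (hzero j k (hj k))
    exact (mul_eq_zero_of_right _ this).symm
  let κ : ℤ → ℝ≥0∞ := fun n => ENNReal.ofReal ((2 : ℝ) ^ ((n : ℝ) * s)) *
    eLpNorm (𝓕⁻ (SchwartzMap.smulLeftCLM ℂ (χ.blockSymbol n) h) : 𝓢(Rn d, ℂ)) p volume
  have hκ : ∀ n, κ n < ∞ := fun n =>
    ENNReal.mul_lt_top ENNReal.ofReal_lt_top (SchwartzMap.eLpNorm_lt_top _ _ _)
  have hκe : ∀ n k, ENNReal.ofReal ((2 : ℝ) ^ (((n + m k : ℤ) : ℝ) * s)) *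
      distLpNorm p (dyadicBlock χ (n + m k) (bump (dilate ((2 : ℝ) ^ m k) (by positivity) h))) =
      ENNReal.ofReal ((2 : ℝ) ^ ((m k : ℝ) * (s - σ))) * κ n := fun n k =>
    besov_dyadicBlock_bump χ p s h n (m k)
  -- After normalization the Besov contribution of a block depends only on its offset `n` from `m
  -- k`, and finitely many offsets occur.
  let K : ℝ≥0∞ := ∑ n ∈ Finset.Icc (-((R : ℤ) + 1)) (R + 1), κ n
  have hKtop : K < ∞ := ENNReal.sum_lt_top.mpr fun n _ => hκ n
  have hnorm : ∀ a, besovENorm p χ s ((polynomials d).mkQ (S a)) ≤ K * ‖a‖ₑ := by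
    intro a
    refine iSup_le fun j => ?_
    change _ * distLpNorm p (dyadicBlock χ j (S a)) ≤ _
    by_cases hj : ∀ k, (R : ℤ) + 1 < |j - m k|
    · rw [hblock0 a j hj, distLpNorm_zero, mul_zero]
      exact zero_le
    · push Not at hj
      obtain ⟨k, hk⟩ := hj
      obtain ⟨n, rfl⟩ : ∃ n, j = n + m k := ⟨j - m k, by ring⟩
      rw [add_sub_cancel_right] at hk
      have hn : κ n ≤ K := Finset.single_le_sum (f := κ) (fun _ _ => zero_le)
        (Finset.mem_Icc.mpr (abs_le.mp hk))
      have hfin : distLpNorm p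
          (dyadicBlock χ (n + m k) (bump (dilate ((2 : ℝ) ^ m k) (by positivity) h))) < ∞ := by
        rw [dyadicBlock_bump, distLpNorm_schwartz]
        exact SchwartzMap.eLpNorm_lt_top _ _ _
      rw [hblock a _ k (by rwa [add_sub_cancel_right])]
      simp only [e]
      rw [map_smul, smul_smul]
      have hwinv : ‖(w k : ℂ)‖ₑ * ENNReal.ofReal ((2 : ℝ) ^ ((m k : ℝ) * (s - σ))) = 1 := by
        rw [← ofReal_norm, Complex.norm_real, Real.norm_of_nonneg (hw k).le,
          ← ENNReal.ofReal_mul (hw k).le, ← Real.rpow_add two_pos, ← mul_add]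
        simp
      calc _ ≤ ENNReal.ofReal ((2 : ℝ) ^ (((n + m k : ℤ) : ℝ) * s)) * (‖a k * (w k : ℂ)‖ₑ *
            distLpNorm p (dyadicBlock χ (n + m k)
              (bump (dilate ((2 : ℝ) ^ m k) (by positivity) h)))) := by
            gcongr
            exact distLpNorm_smul_le p _ _ hfin
        _ = ‖a k‖ₑ * (‖(w k : ℂ)‖ₑ * (ENNReal.ofReal ((2 : ℝ) ^ (((n + m k : ℤ) : ℝ) * s)) *
            distLpNorm p (dyadicBlock χ (n + m k)
              (bump (dilate ((2 : ℝ) ^ m k) (by positivity) h))))) := by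
            rw [enorm_mul]; ring
        _ = ‖a k‖ₑ * κ n := by rw [hκe, ← mul_assoc ‖(w k : ℂ)‖ₑ, hwinv, one_mul]
        _ ≤ ‖a‖ₑ * K := by
            gcongr
            rw [← ofReal_norm, ← ofReal_norm]
            exact ENNReal.ofReal_le_ofReal (a.norm_coe_le_norm k)
        _ = _ := mul_comm _ _
  let T₀ : (ℕ →ᵇ ℂ) →ₗ[ℂ] BesovSpace p χ s :=
    LinearMap.codRestrict (besovSubmodule p χ s) ((polynomials d).mkQ.comp S) fun a =>
      (hnorm a).trans_lt (ENNReal.mul_lt_top hKtop enorm_lt_top)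
  have hT₀ : ∀ a, BesovSpace.incl p χ s (T₀ a) = (polynomials d).mkQ (S a) := fun a => rfl
  let T : (ℕ →ᵇ ℂ) →L[ℂ] BesovSpace p χ s := T₀.mkContinuous K.toReal fun a => by
    rw [BesovSpace.norm_def, hT₀, ← toReal_enorm a, ← ENNReal.toReal_mul]
    exact ENNReal.toReal_mono (ENNReal.mul_lt_top hKtop enorm_lt_top).ne (hnorm a)
  have hT : ∀ a, BesovSpace.incl p χ s (T a) = (polynomials d).mkQ (S a) := fun a => rfl
  refine ⟨T, i, ∫ ξ, SchwartzMap.smulLeftCLM ℂ (χ.blockSymbol i) h ξ, m, hi, fun k => ?_, ?_,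
    fun k => ?_, fun a k => ?_⟩
  · exact (hm k).trans (by simp)
  · exact tendsto_atBot_mono hm (tendsto_neg_atTop_atBot.comp tendsto_natCast_atTop_atTop)
  · have hSk : S (indicatorSeq {k}) = e k := by
      ext u
      refine (hS _ u).unique ?_
      have := hasSum_single (f := fun k' => indicatorSeq {k} k' * e k' u) k fun k' hk' => by
        simp [indicatorSeq_apply, hk']
      simpa [indicatorSeq_apply] using this
    -- The representative in `𝓢'_h` is the piece without the subtracted constant; the class is the
    -- same.
    refine Submodule.mem_map.mpr ⟨(w k : ℂ) • SchwartzMap.toTemperedDistributionCLM (Rn d) ℂ volume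
      (𝓕⁻ (dilate ((2 : ℝ) ^ m k) (by positivity) h)), ?_, ?_⟩
    · refine Submodule.smul_mem _ _ (fourierInv_mem_homogeneousDistributions χ
        (r := (2 : ℝ) ^ m k * 2 ^ (-(R : ℤ))) (by positivity) fun ξ hξ => ?_)
      rw [dilate_apply] at hξ
      have := (hR _ (right_ne_zero_of_smul hξ)).1
      rwa [norm_smul, norm_inv, Real.norm_of_nonneg (by positivity), ← div_eq_inv_mul,
        le_div_iff₀' (by positivity)] at this
    · rw [hT, hSk, map_smul, ← mkQ_bump, ← map_smul]
  -- Otherwise block `i` of `h` would vanish, contrary to its nonzero integral.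
  · have hik : |i| ≤ (R : ℤ) + 1 := by
      by_contra! hcon
      refine hi ?_
      rw [smulLeft_blockSymbol_dilate_eq_zero χ hR hcon]
      simp
    rw [hT, blockFunctional_apply]
    change dyadicBlock χ (i + m k) (S a) _ = _
    rw [hblock a _ k (by rwa [add_sub_cancel_right])]
    simp only [e]
    rw [map_smul]
    change a k • ((w k : ℂ) • dyadicBlock χ (i + m k) (bump _) (𝓕 (χ.blockPlateau (i + m k)))) = _
    rw [dyadicBlock_bump_fourier_blockPlateau, smul_eq_mul, smul_eq_mul]

end Lacunary

end HomBesov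

/-! ### Normalized block functionals and the conclusion -/

theorem theoremt (d : ℕ) (hd : 0 < d) (χ : HomBesov.Cutoff d) (p : ENNReal) [Fact (1 ≤ p)]
    (s : ℝ) (hs : (d : ℝ) * (p⁻¹).toReal ≤ s) :
    ¬ (HomBesov.homogeneousClosure p χ s).ClosedComplemented := by
  obtain ⟨T, i, c, m, hc, hm0, hm, hTs, hTl⟩ := HomBesov.exists_lacunary_embedding χ p s hd
  set σ : ℝ := (d : ℝ) * (p⁻¹).toReal
  let w : ℕ → ℝ := fun k => (2 : ℝ) ^ ((m k : ℝ) * (σ - s))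
  have hw : ∀ k, 0 < w k := fun k => Real.rpow_pos_of_pos two_pos _
  -- Here `s ≥ d/p` is used: with `m k ≤ 0` it makes the exponent nonnegative.
  have hw1 : ∀ k, 1 ≤ w k := fun k => by
    refine Real.one_le_rpow one_le_two (mul_nonneg_of_nonpos_of_nonpos ?_ (sub_nonpos.mpr hs))
    exact_mod_cast hm0 k
  let D : ENNReal := eLpNorm (𝓕 (χ.blockPlateau 0) : 𝓢(HomBesov.Rn d, ℂ)) (1 - p⁻¹)⁻¹ volume
  have hD : D < ⊤ := SchwartzMap.eLpNorm_lt_top _ _ _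
  let K : ℝ := ‖c⁻¹‖ * (D.toReal * (2 : ℝ) ^ ((i : ℝ) * (σ - s)))
  -- The weight `w k` cancels the growth `2^(m k (σ - s))` of the block functional; only the factor
  -- from the fixed offset `i` remains in `K`.
  have hbound : ∀ k (F : HomBesov.BesovSpace p χ s),
      ‖(((w k : ℂ) * c)⁻¹ • (HomBesov.blockFunctional χ (i + m k)).comp
        (HomBesov.BesovSpace.incl p χ s)) F‖ ≤ K * ‖F‖ := by
    intro k F
    have hF := HomBesov.BesovSpace.besovENorm_lt_top p χ s F
    have h1 := HomBesov.enorm_blockFunctional_le χ p s (i + m k) _ hF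
    have h2 := ENNReal.toReal_mono (by finiteness) h1
    rw [toReal_enorm, ENNReal.toReal_mul, ENNReal.toReal_mul,
      ENNReal.toReal_ofReal (by positivity), ← HomBesov.BesovSpace.norm_def] at h2
    have h3 : (2 : ℝ) ^ (((i + m k : ℤ) : ℝ) * (σ - s)) = 2 ^ ((i : ℝ) * (σ - s)) * w k := by
      rw [← Real.rpow_add two_pos]; congr 1; push_cast; ring
    rw [h3] at h2
    rw [LinearMap.smul_apply, LinearMap.comp_apply, norm_smul, mul_inv, norm_mul, norm_inv,
      Complex.norm_real, Real.norm_of_nonneg (hw k).le]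
    calc _ ≤ (w k)⁻¹ * ‖c⁻¹‖ * (D.toReal * (2 ^ ((i : ℝ) * (σ - s)) * w k) * ‖F‖) :=
          mul_le_mul_of_nonneg_left h2 (mul_nonneg (inv_nonneg.mpr (hw k).le) (norm_nonneg _))
      _ = ((w k)⁻¹ * w k) * (K * ‖F‖) := by simp only [K]; ring
      _ = K * ‖F‖ := by rw [inv_mul_cancel₀ (hw k).ne', one_mul]
  refine HomBesov.not_closedComplemented_of_rightInverse (HomBesov.homogeneousPart p χ s) T
    (fun k => LinearMap.mkContinuous _ K (hbound k)) K hbound ?_ ?_ hTs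
  · rintro F ⟨f, hf, hfF⟩
    have h1 : Tendsto (fun k => i + m k) atTop atBot := tendsto_atBot_add_const_left _ _ hm
    have h2 := ((HomBesov.tendsto_blockFunctional_of_homogeneous χ hf).comp h1).norm.const_mul ‖c⁻¹‖
    rw [norm_zero, mul_zero] at h2
    refine squeeze_zero_norm (fun k => ?_) h2
    change ‖((w k : ℂ) * c)⁻¹ • HomBesov.blockFunctional χ (i + m k)
      (HomBesov.BesovSpace.incl p χ s F)‖ ≤ _
    rw [← hfF, norm_smul, mul_inv, norm_mul, norm_inv, Complex.norm_real,
      Real.norm_of_nonneg (hw k).le]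
    exact mul_le_mul_of_nonneg_right
      (mul_le_of_le_one_left (norm_nonneg _) (inv_le_one_of_one_le₀ (hw1 k))) (norm_nonneg _)
  · intro a k
    change ((w k : ℂ) * c)⁻¹ • HomBesov.blockFunctional χ (i + m k)
      (HomBesov.BesovSpace.incl p χ s (T a)) = a k
    rw [hTl, smul_eq_mul, mul_comm (a k), inv_mul_cancel_left₀]
    exact mul_ne_zero (Complex.ofReal_ne_zero.mpr (hw k).ne') hc
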